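/- Let $\mathbb T\subset\mathbb R$ be an interval (finite or infinite), let $\Theta\subset\mathbb R^d$ be open, convex and bounded, and for $\vartheta\in\Theta$ let $\lambda(\vartheta,\cdot):\mathbb T\to(0,\infty)$ be an intensity function with $\int_{\mathbb T}\lambda(\vartheta,t)\,dt<\infty$. Fix $\vartheta_0\in\Theta$, and let $X_1,X_2,\ldots$ be independent Poisson processes on $\mathbb T$ with intensity function $\lambda(\vartheta_0,\cdot)$, i.e. counting processes whose increments over disjoint intervals are independent and whose increment over $(s,t]$ is Poisson distributed with mean $\int_s^t\lambda(\vartheta_0,u)\,du$. Write $\dot\lambda$ for the gradient of $\lambda$ in $\vartheta$ and $$\mathbf I(\vartheta)=\int_{\mathbb T}\dot\lambda(\vartheta,t)\dot\lambda(\vartheta,t)^{\top}\lambda(\vartheta,t)^{-1}\,dt$$ for the Fisher information matrix. Assume: ($\mathcal P_0$) For every $n$, $\bar\vartheta_n$ is an ($\mathbb R^d$-valued) estimator based on $X_1,\ldots,X_n$; the sequence $\bar\vartheta_n$ is consistent, and $\sqrt n(\bar\vartheta_n-\vartheta_0)$ is bounded in probability. ($\mathcal L_0$) For every $t\in\mathbb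 T$ the function $\vartheta\mapsto\ln\lambda(\vartheta,t)$ is three times continuously differentiable on $\Theta$, its derivatives of orders $1,2,3$ are bounded on $\Theta\times\mathbb T$, and $\inf_{\vartheta\in\Theta}\inf_{|\mu|=1}\mu^{\top}\mathbf I(\vartheta)\mu>0$. Let $\delta\in(\tfrac12,1)$, $N=[n^{\delta}]$, and define the one-step MLE by $$\vartheta_n^\star=\bar\vartheta_N+\frac{\mathbf I(\bar\vartheta_N)^{-1}}{n}\sum_{j=N+1}^{n}\int_{\mathbb T}\frac{\dot\lambda(\bar\vartheta_N,t)}{\lambda(\bar\vartheta_N,t)}\bigl[dX_j(t)-\lambda(\bar\vartheta_N,t)\,dt\bigr]$$ if $\bar\vartheta_N\in\Theta$, and $\vartheta_n^\star=\bar\vartheta_N$ otherwise. Then, as $n\to\infty$, $$\sqrt n\,(\vartheta_n^\star-\vartheta_0)\Longrightarrow\mathcal N\bigl(0,\mathbf I(\vartheta_0)^{-1}\bigr).$$ -/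

import Mathlib

open MeasureTheory ProbabilityTheory Filter Topology Set

noncomputable section

namespace PoissonOneStep

/-- A (inhomogeneous) Poisson process on the interval `T` with intensity function `lam`.
The counting process `X(t)` is given by its jump measure `X ω`, a random measure carried by `T`:
`X(t) = X ω (T ∩ (-∞, t])`, the increment over `(s, t]` is `X ω (T ∩ (s, t])`, and
`∫_T f(t) dX(t)` is the integral of `f` against `X ω`.
Increments over disjoint intervals are independent, and the increment over `(s, t]` is Poisson
distributed with mean `∫_{T ∩ (s, t]} lam`. Since `s` may lie to the left of `T`, a jump at a left
endpoint of `T` is also governed by this law (it has probability zero). -/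
structure IsPoissonProcess {Ω : Type*} [MeasurableSpace Ω] (P : Measure Ω) (T : Set ℝ)
    (lam : ℝ → ℝ) (X : Ω → Measure ℝ) : Prop where
  measurable : Measurable X
  carried : ∀ ω, X ω Tᶜ = 0
  increment_law : ∀ s t : ℝ, s < t → ∀ k : ℕ,
    P {ω | X ω (T ∩ Ioc s t) = k} =
      ENNReal.ofReal (Real.exp (-∫ u in T ∩ Ioc s t, lam u) *
        (∫ u in T ∩ Ioc s t, lam u) ^ k / (k.factorial : ℝ))
  indep_increments : ∀ t : ℕ → ℝ, Monotone t →
    iIndepFun (fun (i : ℕ) (ω : Ω) => X ω (T ∩ Ioc (t i) (t (i + 1)))) P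

/-- The vector `λ̇(ϑ, t)` of the first derivatives of the intensity with respect to `ϑ`. -/
def intensityGrad {d : ℕ} (lam : EuclideanSpace ℝ (Fin d) → ℝ → ℝ)
    (θ : EuclideanSpace ℝ (Fin d)) (t : ℝ) : EuclideanSpace ℝ (Fin d) :=
  gradient (fun η => lam η t) θ

/-- The Fisher information matrix `I(ϑ) = ∫_T λ̇(ϑ, t) λ̇(ϑ, t)ᵀ λ(ϑ, t)⁻¹ dt`. -/
def fisherInfo {d : ℕ} (T : Set ℝ) (lam : EuclideanSpace ℝ (Fin d) → ℝ → ℝ)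
    (θ : EuclideanSpace ℝ (Fin d)) : Matrix (Fin d) (Fin d) ℝ :=
  Matrix.of fun i j =>
    ∫ t in T, intensityGrad lam θ t i * intensityGrad lam θ t j * (lam θ t)⁻¹

/-- The score `∫_T λ̇(ϑ, t) λ(ϑ, t)⁻¹ [dx(t) - λ(ϑ, t) dt]` of one observation `x`. -/
def score {d : ℕ} (T : Set ℝ) (lam : EuclideanSpace ℝ (Fin d) → ℝ → ℝ)
    (θ : EuclideanSpace ℝ (Fin d)) (x : Measure ℝ) : EuclideanSpace ℝ (Fin d) :=
  (∫ t in T, (lam θ t)⁻¹ • intensityGrad lam θ t ∂x) -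
    ∫ t in T, lam θ t • ((lam θ t)⁻¹ • intensityGrad lam θ t)

/-- The number `N = [n ^ δ]` of learning observations. -/
def learningSize (δ : ℝ) (n : ℕ) : ℕ := ⌊(n : ℝ) ^ δ⌋₊

/-- The value at the observations `x 0, x 1, …` of an estimator based on the first `n` of them. -/
def evalFirst {d : ℕ} (est : (n : ℕ) → (Fin n → Measure ℝ) → EuclideanSpace ℝ (Fin d))
    (n : ℕ) (x : ℕ → Measure ℝ) : EuclideanSpace ℝ (Fin d) :=
  est n fun j => x j

open Classical in
/-- The one-step MLE
`ϑ̄_N + n⁻¹ I(ϑ̄_N)⁻¹ ∑_{j = N+1}^n ∫_T λ̇(ϑ̄_N, t) λ(ϑ̄_N, t)⁻¹ [dX_j(t) - λ(ϑ̄_N, t) dt]`,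
where `ϑ̄_N` is the preliminary estimator based on the first `N = [n ^ δ]` observations. The
observations are numbered from `0`, so the sum runs over the indices `N, …, n - 1`. The correction
only makes sense if `ϑ̄_N ∈ Θ`; otherwise `ϑ̄_N` is left as it is. -/
def oneStepMLE {d : ℕ} (T : Set ℝ) (Θ : Set (EuclideanSpace ℝ (Fin d)))
    (lam : EuclideanSpace ℝ (Fin d) → ℝ → ℝ) (δ : ℝ)
    (est : (n : ℕ) → (Fin n → Measure ℝ) → EuclideanSpace ℝ (Fin d))
    (n : ℕ) (x : ℕ → Measure ℝ) : EuclideanSpace ℝ (Fin d) :=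
  let N := learningSize δ n
  let θ := evalFirst est N x
  if θ ∈ Θ then
    θ + (n : ℝ)⁻¹ •
      Matrix.toEuclideanLin (fisherInfo T lam θ)⁻¹ (∑ j ∈ Finset.Ico N n, score T lam θ (x j))
  else θ

/-- The preliminary estimator is consistent, and `√n (ϑ̄_n - ϑ₀)` is bounded in probability. -/
structure ConditionP0 {Ω : Type*} [MeasurableSpace Ω] (P : Measure Ω) {d : ℕ}
    (θ₀ : EuclideanSpace ℝ (Fin d)) (X : ℕ → Ω → Measure ℝ)
    (est : (n : ℕ) → (Fin n → Measure ℝ) → EuclideanSpace ℝ (Fin d)) : Prop where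
  consistent : TendstoInMeasure P (fun n ω => evalFirst est n fun j => X j ω) atTop fun _ => θ₀
  bounded_in_prob : ∀ ε : ℝ, 0 < ε → ∃ M : ℝ, ∀ n : ℕ,
    P {ω | M < ‖√(n : ℝ) • (evalFirst est n (fun j => X j ω) - θ₀)‖} ≤ ENNReal.ofReal ε

/-- `ln λ(ϑ, t)` has three continuous derivatives with respect to `ϑ`, bounded on `Θ × T`, and the
Fisher information matrix is uniformly nondegenerate on `Θ`. -/
structure ConditionL0 {d : ℕ} (T : Set ℝ) (Θ : Set (EuclideanSpace ℝ (Fin d)))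
    (lam : EuclideanSpace ℝ (Fin d) → ℝ → ℝ) : Prop where
  pos : ∀ θ ∈ Θ, ∀ t ∈ T, 0 < lam θ t
  contDiffOn : ∀ t ∈ T, ContDiffOn ℝ 3 (fun θ => Real.log (lam θ t)) Θ
  bounded : ∃ C : ℝ, ∀ k ∈ Finset.Icc 1 3, ∀ θ ∈ Θ, ∀ t ∈ T,
    ‖iteratedFDeriv ℝ k (fun η => Real.log (lam η t)) θ‖ ≤ C
  nondegenerate : ∃ c : ℝ, 0 < c ∧ ∀ θ ∈ Θ, ∀ μ : EuclideanSpace ℝ (Fin d), ‖μ‖ = 1 →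
    c ≤ inner ℝ μ (Matrix.toEuclideanLin (fisherInfo T lam θ) μ)

end PoissonOneStep

end

open PoissonOneStep

/-! A preliminary estimator `θ` from `N` observations has error of order `N ^ (-1/2)`. As the score
at `θ` has mean `I(θ) (θ₀ - θ)` up to a second-order error, one Newton step leaves a bias of order
`‖θ - θ₀‖ ^ 2 = O(1 / N)`, and `√n / N → 0` because `δ > 1/2`. What remains is the normalised sum
of the centred influence functions at `θ` over the observations after the first `N`. These are
independent of `θ`, so given `θ` the second moment of a compensated Poisson integral bounds the
effect of replacing `θ` by `θ₀`. Adding the first `N` observations back changes nothing in the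
limit, since `N / n → 0`, and the sum over all `n` obeys the central limit theorem, which is read
off the characteristic functional `exp (∫ (e^{if} - 1) dΛ)` of a Poisson random measure. That
functional follows from the Poisson law of the increments by approximating `f` by step functions. -/

namespace PoissonOneStep

open scoped ENNReal NNReal

section ComplexExponential

lemma norm_cexp_mul_I_sub_cexp_mul_I_le (a b : ℝ) :
    ‖Complex.exp (a * Complex.I) - Complex.exp (b * Complex.I)‖ ≤ ‖a - b‖ := by
  have h : Complex.exp (a * Complex.I) - Complex.exp (b * Complex.I) =
      Complex.exp (b * Complex.I) * (Complex.exp (Complex.I * (a - b : ℝ)) - 1) := by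
    rw [mul_sub, ← Complex.exp_add]
    push_cast
    ring_nf
  rw [h, norm_mul, Complex.norm_exp_ofReal_mul_I, one_mul]
  exact Real.norm_exp_I_mul_ofReal_sub_one_le

lemma norm_cexp_sub_one_le_of_re_nonpos {w : ℂ} (hw : w.re ≤ 0) : ‖Complex.exp w - 1‖ ≤ ‖w‖ := by
  have h := (convex_halfSpace_re_le 0).norm_image_sub_le_of_norm_hasDerivWithin_le (C := 1)
    (fun z _ => (Complex.hasDerivAt_exp z).hasDerivWithinAt) (fun z hz => ?_)
    (show (0 : ℂ) ∈ {z : ℂ | z.re ≤ 0} by simp) (show w ∈ {z : ℂ | z.re ≤ 0} from hw)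
  · simpa using h
  · rw [Complex.norm_exp]
    exact Real.exp_le_one_iff.2 hz

/-- The function `e^{ix} - 1 - ix`: the characteristic exponent of a Poisson variable of mean `1`,
centred at its mean. -/
noncomputable def compensatedCexp (x : ℝ) : ℂ := Complex.exp (x * Complex.I) - 1 - x * Complex.I

@[fun_prop]
lemma continuous_compensatedCexp : Continuous compensatedCexp := by
  unfold compensatedCexp
  fun_prop

lemma re_compensatedCexp_nonpos (x : ℝ) : (compensatedCexp x).re ≤ 0 := by
  simpa [compensatedCexp, Complex.exp_ofReal_mul_I_re] using Real.cos_le_one x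

lemma norm_compensatedCexp_le (x : ℝ) : ‖compensatedCexp x‖ ≤ x ^ 2 := by
  have hd (y : ℝ) : HasDerivAt compensatedCexp
      (Complex.exp (y * Complex.I) * Complex.I - Complex.I) y := by
    have h1 : HasDerivAt (fun y : ℝ => (y : ℂ) * Complex.I) Complex.I y := by
      simpa using (Complex.ofRealCLM.hasDerivAt (x := y)).mul_const Complex.I
    exact (h1.cexp.sub_const 1).sub h1
  have h := (convex_uIcc (0 : ℝ) x).norm_image_sub_le_of_norm_hasDerivWithin_le (C := |x|)
    (fun y _ => (hd y).hasDerivWithinAt) (fun y hy => ?_) left_mem_uIcc right_mem_uIcc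
  · simpa [compensatedCexp, ← sq_abs x, sq] using h
  · have e : Complex.exp (y * Complex.I) * Complex.I - Complex.I =
        (Complex.exp (y * Complex.I) - Complex.exp ((0 : ℝ) * Complex.I)) * Complex.I := by
      simp [sub_mul]
    rw [e, norm_mul, Complex.norm_I, mul_one]
    refine (norm_cexp_mul_I_sub_cexp_mul_I_le y 0).trans ?_
    simpa using abs_sub_left_of_mem_uIcc hy

lemma norm_compensatedCexp_add_sq_div_two_le (x : ℝ) :
    ‖compensatedCexp x + (x ^ 2 / 2 : ℝ)‖ ≤ |x| ^ 3 * Real.exp |x| := by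
  have h := Complex.norm_exp_sub_sum_le_norm_mul_exp (x * Complex.I) 3
  rw [norm_mul, Complex.norm_I, mul_one, Complex.norm_real, Real.norm_eq_abs] at h
  convert! h using 2
  simp only [compensatedCexp, Finset.sum_range_succ, Finset.sum_range_zero, mul_pow, Complex.I_sq,
    Nat.factorial]
  push_cast
  ring

lemma tendsto_natCast_mul_compensatedCexp (x : ℝ) :
    Tendsto (fun n : ℕ => (n : ℂ) * compensatedCexp ((√(n : ℝ))⁻¹ * x)) atTop
      (𝓝 (-(x ^ 2 / 2 : ℝ))) := by
  rw [tendsto_iff_norm_sub_tendsto_zero]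
  have hlim : Tendsto (fun n : ℕ => |x| ^ 3 * Real.exp |x| * (√(n : ℝ))⁻¹) atTop (𝓝 0) := by
    have := (tendsto_inv_atTop_zero.comp (Real.tendsto_sqrt_atTop.comp
      tendsto_natCast_atTop_atTop)).const_mul (|x| ^ 3 * Real.exp |x|)
    simpa using this
  refine squeeze_zero' (Eventually.of_forall fun _ => norm_nonneg _) ?_ hlim
  filter_upwards [eventually_ge_atTop 1] with n hn
  have hs : 1 ≤ √(n : ℝ) := Real.one_le_sqrt.2 (by exact_mod_cast hn)
  have hsq : (n : ℝ) = √(n : ℝ) ^ 2 := (Real.sq_sqrt (by positivity)).symm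
  set r := √(n : ℝ)
  have hsplit : (n : ℂ) * compensatedCexp (r⁻¹ * x) - -((x ^ 2 / 2 : ℝ) : ℂ) =
      n * (compensatedCexp (r⁻¹ * x) + ((r⁻¹ * x) ^ 2 / 2 : ℝ)) := by
    have : (n : ℝ) * ((r⁻¹ * x) ^ 2 / 2) = x ^ 2 / 2 := by
      rw [hsq]
      field_simp
    rw [← this]
    push_cast
    ring
  have habs : |r⁻¹ * x| = r⁻¹ * |x| := by rw [abs_mul, abs_of_nonneg (by positivity)]
  calc ‖(n : ℂ) * compensatedCexp (r⁻¹ * x) - -((x ^ 2 / 2 : ℝ) : ℂ)‖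
      ≤ n * (|r⁻¹ * x| ^ 3 * Real.exp |r⁻¹ * x|) := by
        rw [hsplit, norm_mul, Complex.norm_natCast]
        gcongr
        exact norm_compensatedCexp_add_sq_div_two_le _
    _ ≤ n * ((r⁻¹ * |x|) ^ 3 * Real.exp |x|) := by
        rw [habs]
        gcongr
        exact mul_le_of_le_one_left (abs_nonneg _) (inv_le_one_of_one_le₀ hs)
    _ = |x| ^ 3 * Real.exp |x| * r⁻¹ := by
        rw [hsq]
        field_simp

variable {α : Type*} [MeasurableSpace α]

lemma integrable_cexp_mul_I (μ : Measure α) [IsFiniteMeasure μ] {f : α → ℝ} (hf : Measurable f) :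
    Integrable (fun x => Complex.exp (f x * Complex.I)) μ :=
  Integrable.of_bound (C := 1) (Measurable.aestronglyMeasurable (by fun_prop))
    (ae_of_all _ fun _ => (Complex.norm_exp_ofReal_mul_I _).le)

lemma enorm_integral_cexp_sub_integral_cexp_le (μ : Measure α) [IsFiniteMeasure μ] {f g : α → ℝ}
    (hf : Measurable f) (hg : Measurable g) :
    ‖∫ x, Complex.exp (f x * Complex.I) ∂μ - ∫ x, Complex.exp (g x * Complex.I) ∂μ‖ₑ ≤
      ∫⁻ x, ‖f x - g x‖ₑ ∂μ := by
  rw [← integral_sub (integrable_cexp_mul_I μ hf) (integrable_cexp_mul_I μ hg)]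
  exact (enorm_integral_le_lintegral_enorm _).trans (lintegral_mono fun x =>
    enorm_le_iff_norm_le.2 (norm_cexp_mul_I_sub_cexp_mul_I_le _ _))

variable {f : α → ℝ} {B : ℝ}

lemma integrable_of_measurable_of_bound {F : Type*} [NormedAddCommGroup F] [MeasurableSpace F]
    [BorelSpace F] [SecondCountableTopology F] (μ : Measure α) [IsFiniteMeasure μ] {f : α → F}
    (hf : Measurable f) (hB : ∀ x, ‖f x‖ ≤ B) : Integrable f μ :=
  Integrable.of_bound hf.aestronglyMeasurable B (ae_of_all _ hB)

lemma integrable_sq_of_measurable_of_bound (μ : Measure α) [IsFiniteMeasure μ] (hf : Measurable f)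
    (hB : ∀ x, ‖f x‖ ≤ B) : Integrable (fun x => f x ^ 2) μ :=
  integrable_of_measurable_of_bound (B := B ^ 2) μ (hf.pow_const 2) fun x => by
    rw [norm_pow]
    gcongr
    exact hB x

lemma integral_compensatedCexp (μ : Measure α) [IsFiniteMeasure μ] (hf : Measurable f)
    (hB : ∀ x, ‖f x‖ ≤ B) : ∫ x, compensatedCexp (f x) ∂μ =
      ∫ x, (Complex.exp (f x * Complex.I) - 1) ∂μ - (∫ x, f x ∂μ : ℝ) * Complex.I := by
  have hexp : Integrable (fun x => Complex.exp (f x * Complex.I) - 1) μ :=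
    (integrable_cexp_mul_I μ hf).sub (integrable_const _)
  have hlin : Integrable (fun x => (f x : ℂ) * Complex.I) μ :=
    (integrable_of_measurable_of_bound μ hf hB).ofReal.mul_const _
  simp only [compensatedCexp]
  rw [integral_sub hexp hlin, integral_mul_const, integral_complex_ofReal]

lemma re_integral_compensatedCexp_nonpos (μ : Measure α) [IsFiniteMeasure μ] (hf : Measurable f)
    (hB : ∀ x, ‖f x‖ ≤ B) : (∫ x, compensatedCexp (f x) ∂μ).re ≤ 0 := by
  have hint : Integrable (fun x => compensatedCexp (f x)) μ :=
    (integrable_sq_of_measurable_of_bound μ hf hB).mono'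
      (Measurable.aestronglyMeasurable (by fun_prop))
      (ae_of_all _ fun _ => norm_compensatedCexp_le _)
  rw [← RCLike.re_eq_complex_re, ← integral_re hint]
  exact integral_nonpos fun x => re_compensatedCexp_nonpos _

lemma norm_integral_compensatedCexp_le (μ : Measure α) [IsFiniteMeasure μ] (hf : Measurable f)
    (hB : ∀ x, ‖f x‖ ≤ B) : ‖∫ x, compensatedCexp (f x) ∂μ‖ ≤ ∫ x, f x ^ 2 ∂μ :=
  norm_integral_le_of_norm_le (integrable_sq_of_measurable_of_bound μ hf hB)
    (ae_of_all _ fun _ => norm_compensatedCexp_le _)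

lemma tendsto_natCast_mul_integral_compensatedCexp (μ : Measure α) [IsFiniteMeasure μ]
    (hf : Measurable f) (hB : ∀ x, ‖f x‖ ≤ B) :
    Tendsto (fun n : ℕ => (n : ℂ) * ∫ x, compensatedCexp ((√(n : ℝ))⁻¹ * f x) ∂μ) atTop
      (𝓝 (-((∫ x, f x ^ 2 ∂μ) / 2 : ℝ))) := by
  have e : (-((∫ x, f x ^ 2 ∂μ) / 2 : ℝ) : ℂ) = ∫ x, -((f x ^ 2 / 2 : ℝ) : ℂ) ∂μ := by
    rw [integral_neg, integral_complex_ofReal, integral_div]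
  rw [e]
  simp only [← integral_const_mul]
  refine tendsto_integral_of_dominated_convergence (fun x => f x ^ 2)
    (fun n => Measurable.aestronglyMeasurable (by fun_prop))
    (integrable_sq_of_measurable_of_bound μ hf hB) (fun n => ae_of_all _ fun x => ?_)
    (ae_of_all _ fun x => tendsto_natCast_mul_compensatedCexp (f x))
  rcases n.eq_zero_or_pos with rfl | hn
  · simpa using sq_nonneg (f x)
  rw [norm_mul, Complex.norm_natCast]
  calc (n : ℝ) * ‖compensatedCexp ((√(n : ℝ))⁻¹ * f x)‖ ≤ n * ((√(n : ℝ))⁻¹ * f x) ^ 2 := by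
        gcongr
        exact norm_compensatedCexp_le _
    _ = f x ^ 2 := by
        rw [mul_pow, inv_pow, Real.sq_sqrt (by positivity), mul_inv_cancel_left₀ (by positivity)]

end ComplexExponential

section SecondMoment

variable {μ : Measure ℝ} [IsProbabilityMeasure μ]

lemma tendsto_two_mul_one_sub_cos_div_sq (x : ℝ) :
    Tendsto (fun s : ℝ => 2 * (1 - Real.cos (s * x)) / s ^ 2) (𝓝[≠] 0) (𝓝 (x ^ 2)) := by
  have hd : HasDerivAt (fun s : ℝ => 2 * Real.sin (s * x / 2)) x 0 := by
    have h := (((hasDerivAt_id (0 : ℝ)).mul_const x).div_const 2).sin.const_mul 2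
    convert! h using 1
    simp only [id, zero_mul, zero_div, Real.cos_zero, one_mul]
    ring
  refine ((hd.tendsto_slope_zero).pow 2).congr fun s => ?_
  have hcos : Real.cos (s * x) = 1 - 2 * Real.sin (s * x / 2) ^ 2 := by
    rw [← Real.cos_two_mul_eq_one_sub]
    ring_nf
  simp only [zero_add, zero_mul, zero_div, Real.sin_zero, mul_zero, sub_zero, smul_eq_mul, hcos]
  ring

lemma integral_one_sub_cos_le_norm_charFun_sub_one (s : ℝ) :
    ∫ x, (1 - Real.cos (s * x)) ∂μ ≤ ‖charFun μ s - 1‖ := by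
  have hexp : Integrable (fun x : ℝ => Complex.exp ((s * x : ℝ) * Complex.I)) μ :=
    integrable_cexp_mul_I μ (by fun_prop)
  have hre : ∫ x, (1 - Real.cos (s * x)) ∂μ = (1 - charFun μ s).re := by
    simp only [charFun_apply_real, ← Complex.ofReal_mul, ← Complex.exp_ofReal_mul_I_re]
    rw [Complex.sub_re, ← RCLike.re_eq_complex_re, ← integral_re hexp,
      integral_sub (integrable_const _) hexp.re]
    simp
  rw [hre, norm_sub_rev]
  exact Complex.re_le_norm _

lemma lintegral_enorm_sq_le_of_norm_charFun_sub_one_le {V : ℝ}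
    (h : ∀ s, ‖charFun μ s - 1‖ ≤ s ^ 2 * V) : ∫⁻ x, ‖x‖ₑ ^ 2 ∂μ ≤ ENNReal.ofReal (2 * V) := by
  have hs (n : ℕ) : 0 < 1 / ((n : ℝ) + 1) := Nat.one_div_pos_of_nat
  have hs' : Tendsto (fun n : ℕ => 1 / ((n : ℝ) + 1)) atTop (𝓝[≠] 0) :=
    tendsto_nhdsWithin_iff.2 ⟨tendsto_one_div_add_atTop_nhds_zero_nat,
      Eventually.of_forall fun n => (hs n).ne'⟩
  let F (s x : ℝ) : ℝ := 2 * (1 - Real.cos (s * x)) / s ^ 2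
  have hlim (x : ℝ) : Tendsto (fun n : ℕ => ENNReal.ofReal (F (1 / ((n : ℝ) + 1)) x)) atTop
      (𝓝 (‖x‖ₑ ^ 2)) := by
    have : ‖x‖ₑ ^ 2 = ENNReal.ofReal (x ^ 2) := by
      rw [← ofReal_norm, ← ENNReal.ofReal_pow (norm_nonneg _), Real.norm_eq_abs, sq_abs]
    rw [this]
    exact ENNReal.tendsto_ofReal ((tendsto_two_mul_one_sub_cos_div_sq x).comp hs')
  have hbound (s : ℝ) (hs : 0 < s) : ∫⁻ x, ENNReal.ofReal (F s x) ∂μ ≤ ENNReal.ofReal (2 * V) := by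
    have hF : Integrable (F s) μ := by
      have : Integrable (fun x => Real.cos (s * x)) μ := Integrable.of_bound (C := 1)
        (Measurable.aestronglyMeasurable (by fun_prop)) (ae_of_all _ fun _ => Real.abs_cos_le_one _)
      exact (((integrable_const 1).sub this).const_mul 2).div_const _
    rw [← ofReal_integral_eq_lintegral_ofReal hF (ae_of_all _ fun x => div_nonneg
      (mul_nonneg zero_le_two (sub_nonneg.2 (Real.cos_le_one _))) (sq_nonneg _)), integral_div,
      integral_const_mul]
    refine ENNReal.ofReal_le_ofReal ((div_le_iff₀ (by positivity)).2 ?_)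
    linarith [(integral_one_sub_cos_le_norm_charFun_sub_one s).trans (h s)]
  calc ∫⁻ x, ‖x‖ₑ ^ 2 ∂μ
      = ∫⁻ x, liminf (fun n : ℕ => ENNReal.ofReal (F (1 / ((n : ℝ) + 1)) x)) atTop ∂μ :=
        lintegral_congr fun x => (hlim x).liminf_eq.symm
    _ ≤ liminf (fun n : ℕ => ∫⁻ x, ENNReal.ofReal (F (1 / ((n : ℝ) + 1)) x) ∂μ) atTop :=
        lintegral_liminf_le fun n => Measurable.ennreal_ofReal (by fun_prop)
    _ ≤ ENNReal.ofReal (2 * V) :=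
        (liminf_le_liminf (Eventually.of_forall fun n => hbound _ (hs n))).trans (by simp)

end SecondMoment

section RandomMeasure

variable {α : Type*} [MeasurableSpace α]

lemma isSFiniteKernel_of_isFiniteMeasure {β : Type*} [MeasurableSpace β] (κ : Kernel β α)
    [∀ b, IsFiniteMeasure (κ b)] : IsSFiniteKernel κ := by
  classical
  have hs (n : ℕ) : MeasurableSet {b | ⌊(κ b univ).toReal⌋₊ = n} :=
    Nat.measurable_floor.comp (κ.measurable_coe MeasurableSet.univ).ennreal_toReal
      (measurableSet_singleton n)
  refine ⟨⟨fun n => Kernel.piecewise (hs n) κ 0, fun n => ⟨n + 1, by finiteness, fun b => ?_⟩, ?_⟩⟩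
  · rw [Kernel.piecewise_apply]
    split_ifs with h
    · have hlt : (κ b univ).toReal < n + 1 := by
        rw [← show ⌊(κ b univ).toReal⌋₊ = n from h]
        exact Nat.lt_floor_add_one _
      exact (ENNReal.le_ofReal_iff_toReal_le (measure_ne_top _ _) (by positivity)).2 hlt.le
        |>.trans (by simp [ENNReal.ofReal_add])
    · simp
  · ext b s hb
    rw [Kernel.sum_apply, Measure.sum_apply _ hb, tsum_eq_single ⌊(κ b univ).toReal⌋₊]
    · simp [Kernel.piecewise_apply]
    · intro n hn
      rw [Kernel.piecewise_apply, if_neg fun h => hn (mem_ofPred.1 h).symm]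
      simp

/-- The kernel sending a finite measure to itself and an infinite one to `0`. Unlike the identity
kernel it is s-finite, so that integrals against a random measure depend measurably on
parameters. -/
noncomputable def finitePart : Kernel (Measure α) α where
  toFun := {x : Measure α | x univ < ∞}.indicator id
  measurable' := measurable_id.indicator
    (measurableSet_lt (Measure.measurable_coe MeasurableSet.univ) measurable_const)

lemma finitePart_of_lt_top {x : Measure α} (hx : x univ < ∞) : finitePart x = x :=
  indicator_of_mem (s := {x : Measure α | x univ < ∞}) (f := id) hx

instance (x : Measure α) : IsFiniteMeasure (finitePart x) := by
  by_cases hx : x univ < ∞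
  · rw [finitePart_of_lt_top hx]
    exact ⟨hx⟩
  · rw [show finitePart x = 0 from
      indicator_of_notMem (s := {x : Measure α | x univ < ∞}) (f := id) hx]
    infer_instance

instance : IsSFiniteKernel (finitePart (α := α)) := isSFiniteKernel_of_isFiniteMeasure _

variable {E F G : Type*} [MeasurableSpace E] [NormedAddCommGroup F] [NormedSpace ℝ F]
  [NormedAddCommGroup G] [NormedSpace ℝ G]

/-- The integral of `f` with respect to the centred measure `x - Λ`, where an infinite measure `x`
is replaced by `0`. -/
noncomputable def compensatedIntegral (Λ : Measure α) (f : α → F) (x : Measure α) : F :=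
  ∫ t, f t ∂(finitePart x) - ∫ t, f t ∂Λ

variable [MeasurableSpace F] [BorelSpace F] [SecondCountableTopology F]

lemma measurable_integral_of_measurable_uncurry (Λ : Measure α) [SFinite Λ] {g : E → α → F}
    (hg : Measurable (Function.uncurry g)) : Measurable fun θ => ∫ t, g θ t ∂Λ :=
  (hg.stronglyMeasurable.integral_prod_right (ν := Λ)).measurable

lemma measurable_compensatedIntegral_uncurry (Λ : Measure α) [SFinite Λ] {g : E → α → F}
    (hg : Measurable (Function.uncurry g)) :
    Measurable fun p : E × Measure α => compensatedIntegral Λ (g p.1) p.2 := by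
  refine Measurable.sub (StronglyMeasurable.measurable ?_)
    ((measurable_integral_of_measurable_uncurry Λ hg).comp measurable_fst)
  have hg' : Measurable fun q : (E × Measure α) × α => g q.1.1 q.2 :=
    hg.comp ((measurable_fst.comp measurable_fst).prodMk measurable_snd)
  exact hg'.stronglyMeasurable.integral_kernel_prod_right' (κ := Kernel.prodMkLeft E finitePart)

lemma measurable_compensatedIntegral (Λ : Measure α) [SFinite Λ] {f : α → F} (hf : Measurable f) :
    Measurable (compensatedIntegral Λ f) :=
  (measurable_compensatedIntegral_uncurry Λ (g := fun _ : Unit => f)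
    (hf.comp measurable_snd)).comp (measurable_prodMk_left (x := ()))

variable (Λ : Measure α) [IsFiniteMeasure Λ] {f g : α → F} {B : ℝ}

lemma compensatedIntegral_sub (hf : Measurable f) (hg : Measurable g) (hfB : ∀ t, ‖f t‖ ≤ B)
    (hgB : ∀ t, ‖g t‖ ≤ B) (x : Measure α) :
    compensatedIntegral Λ (fun t => f t - g t) x =
      compensatedIntegral Λ f x - compensatedIntegral Λ g x := by
  simp only [compensatedIntegral]
  rw [integral_sub (integrable_of_measurable_of_bound _ hf hfB)
      (integrable_of_measurable_of_bound _ hg hgB),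
    integral_sub (integrable_of_measurable_of_bound _ hf hfB)
      (integrable_of_measurable_of_bound _ hg hgB), sub_sub_sub_comm]

lemma compensatedIntegral_clm_comp [CompleteSpace F] [CompleteSpace G] (L : F →L[ℝ] G)
    (hf : Measurable f) (hB : ∀ t, ‖f t‖ ≤ B) (x : Measure α) :
    compensatedIntegral Λ (fun t => L (f t)) x = L (compensatedIntegral Λ f x) := by
  simp only [compensatedIntegral, map_sub,
    L.integral_comp_comm (integrable_of_measurable_of_bound _ hf hB)]

end RandomMeasure

section PoissonRandomMeasure

variable {Ω α : Type*} [MeasurableSpace Ω] [MeasurableSpace α]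

/-- A Poisson random measure with finite intensity measure `Λ`, characterised by its characteristic
functional on bounded functions. -/
structure IsPoissonRandomMeasure (P : Measure Ω) (Λ : Measure α) (X : Ω → Measure α) : Prop where
  measurable : Measurable X
  ae_lt_top : ∀ᵐ ω ∂P, X ω univ < ∞
  integral_cexp : ∀ {f : α → ℝ} {B : ℝ}, Measurable f → (∀ t, ‖f t‖ ≤ B) →
    ∫ ω, Complex.exp ((∫ t, f t ∂(X ω) : ℝ) * Complex.I) ∂P =
      Complex.exp (∫ t, (Complex.exp (f t * Complex.I) - 1) ∂Λ)

variable {P : Measure Ω} {Λ : Measure α}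

lemma IsPoissonRandomMeasure.ae_finitePart_eq {X : Ω → Measure α}
    (hX : IsPoissonRandomMeasure P Λ X) : ∀ᵐ ω ∂P, finitePart (X ω) = X ω :=
  hX.ae_lt_top.mono fun _ => finitePart_of_lt_top

variable [IsFiniteMeasure Λ] {B : ℝ}

section CharFun

variable {F : Type*} [NormedAddCommGroup F] [InnerProductSpace ℝ F] [CompleteSpace F]
  [MeasurableSpace F] [BorelSpace F] [SecondCountableTopology F] {f : α → F}

lemma IsPoissonRandomMeasure.charFun_map_compensatedIntegral {X : Ω → Measure α}
    (hX : IsPoissonRandomMeasure P Λ X) (hf : Measurable f) (hB : ∀ t, ‖f t‖ ≤ B) (u : F) :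
    charFun (P.map fun ω => compensatedIntegral Λ f (X ω)) u =
      Complex.exp (∫ t, compensatedCexp (inner ℝ u (f t)) ∂Λ) := by
  have hm : Measurable fun ω => compensatedIntegral Λ f (X ω) :=
    (measurable_compensatedIntegral Λ hf).comp hX.measurable
  have hfu : Measurable fun t => inner ℝ u (f t) := by fun_prop
  have hBu (t : α) : ‖inner ℝ u (f t)‖ ≤ ‖u‖ * B :=
    (norm_inner_le_norm _ _).trans (by gcongr; exact hB t)
  have hinner : (fun ω => Complex.exp (inner ℝ (compensatedIntegral Λ f (X ω)) u * Complex.I))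
      =ᵐ[P] fun ω => Complex.exp ((∫ t, inner ℝ u (f t) ∂(X ω) : ℝ) * Complex.I) *
        Complex.exp (-((∫ t, inner ℝ u (f t) ∂Λ : ℝ) * Complex.I)) := by
    filter_upwards [hX.ae_finitePart_eq] with ω hω
    have h := compensatedIntegral_clm_comp Λ (innerSL ℝ u) hf hB (X ω)
    rw [innerSL_apply_apply] at h
    rw [real_inner_comm, ← h, ← Complex.exp_add]
    simp only [compensatedIntegral, hω, innerSL_apply_apply]
    push_cast
    ring_nf
  rw [charFun_apply, integral_map hm.aemeasurable (by fun_prop), integral_congr_ae hinner,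
    integral_mul_const, hX.integral_cexp hfu hBu, ← Complex.exp_add,
    integral_compensatedCexp Λ hfu hBu, sub_eq_add_neg]

variable {ι : Type*} {X : ι → Ω → Measure α}

lemma charFun_map_sum_compensatedIntegral (hX : ∀ j, IsPoissonRandomMeasure P Λ (X j))
    (hindep : iIndepFun X P) (hf : Measurable f) (hB : ∀ t, ‖f t‖ ≤ B) (S : Finset ι) (u : F) :
    charFun (P.map fun ω => ∑ j ∈ S, compensatedIntegral Λ f (X j ω)) u =
      Complex.exp (S.card * ∫ t, compensatedCexp (inner ℝ u (f t)) ∂Λ) := by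
  have hm (j : ι) : Measurable fun ω => compensatedIntegral Λ f (X j ω) :=
    (measurable_compensatedIntegral Λ hf).comp (hX j).measurable
  have hind : iIndepFun (fun j ω => compensatedIntegral Λ f (X j ω)) P :=
    hindep.comp (fun _ => compensatedIntegral Λ f) fun _ => measurable_compensatedIntegral Λ hf
  rw [(hind.restrict _).charFun_map_fun_finsetSum_eq_prod fun j _ => (hm j).aemeasurable,
    Finset.prod_apply]
  simp only [(hX _).charFun_map_compensatedIntegral hf hB, Finset.prod_const, Complex.exp_nat_mul]

end CharFun

section SecondMoment

variable [IsProbabilityMeasure P] {ι : Type*} {X : ι → Ω → Measure α}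

lemma lintegral_enorm_sq_sum_compensatedIntegral_le_real
    (hX : ∀ j, IsPoissonRandomMeasure P Λ (X j)) (hindep : iIndepFun X P) {f : α → ℝ}
    (hf : Measurable f) (hB : ∀ t, ‖f t‖ ≤ B) (S : Finset ι) :
    ∫⁻ ω, ‖∑ j ∈ S, compensatedIntegral Λ f (X j ω)‖ₑ ^ 2 ∂P ≤
      2 * S.card * ∫⁻ t, ‖f t‖ₑ ^ 2 ∂Λ := by
  have hm : Measurable fun ω => ∑ j ∈ S, compensatedIntegral Λ f (X j ω) :=
    Finset.measurable_fun_sum S fun j _ =>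
      (measurable_compensatedIntegral Λ hf).comp (hX j).measurable
  have hchar (s : ℝ) :
      ‖charFun (P.map fun ω => ∑ j ∈ S, compensatedIntegral Λ f (X j ω)) s - 1‖ ≤
        s ^ 2 * (S.card * ∫ t, f t ^ 2 ∂Λ) := by
    have hfs : Measurable fun t => inner ℝ s (f t) := by fun_prop
    have hBs (t : α) : ‖inner ℝ s (f t)‖ ≤ ‖s‖ * B :=
      (norm_inner_le_norm _ _).trans (by gcongr; exact hB t)
    rw [charFun_map_sum_compensatedIntegral hX hindep hf hB]
    refine (norm_cexp_sub_one_le_of_re_nonpos ?_).trans ?_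
    · rw [← Complex.ofReal_natCast, Complex.re_ofReal_mul]
      exact mul_nonpos_of_nonneg_of_nonpos (by positivity)
        (re_integral_compensatedCexp_nonpos Λ hfs hBs)
    · rw [norm_mul, Complex.norm_natCast, mul_left_comm, ← integral_const_mul]
      gcongr
      simpa [mul_pow, mul_comm] using norm_integral_compensatedCexp_le Λ hfs hBs
  have : IsProbabilityMeasure (P.map fun ω => ∑ j ∈ S, compensatedIntegral Λ f (X j ω)) :=
    Measure.isProbabilityMeasure_map hm.aemeasurable
  have h := lintegral_enorm_sq_le_of_norm_charFun_sub_one_le hchar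
  rw [lintegral_map (by fun_prop) hm] at h
  refine h.trans_eq ?_
  rw [← mul_assoc, ENNReal.ofReal_mul (by positivity), ENNReal.ofReal_mul (by positivity),
    ofReal_integral_eq_lintegral_ofReal (integrable_sq_of_measurable_of_bound Λ hf hB)
      (ae_of_all _ fun _ => sq_nonneg _)]
  simp [← ofReal_norm, ← ENNReal.ofReal_pow]

variable {κ : Type*} [Fintype κ]

lemma enorm_sq_eq_sum (v : EuclideanSpace ℝ κ) : ‖v‖ₑ ^ 2 = ∑ i, ‖v i‖ₑ ^ 2 := by
  simp only [← ofReal_norm, ← ENNReal.ofReal_pow (norm_nonneg _)]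
  rw [EuclideanSpace.norm_sq_eq, ENNReal.ofReal_sum_of_nonneg fun _ _ => by positivity]

lemma lintegral_enorm_sq_sum_compensatedIntegral_le
    (hX : ∀ j, IsPoissonRandomMeasure P Λ (X j)) (hindep : iIndepFun X P)
    {f : α → EuclideanSpace ℝ κ} (hf : Measurable f) (hB : ∀ t, ‖f t‖ ≤ B) (S : Finset ι) :
    ∫⁻ ω, ‖∑ j ∈ S, compensatedIntegral Λ f (X j ω)‖ₑ ^ 2 ∂P ≤
      2 * S.card * ∫⁻ t, ‖f t‖ₑ ^ 2 ∂Λ := by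
  have hfm (i : κ) : Measurable fun t => f t i := by fun_prop
  have hfB (i : κ) (t : α) : ‖f t i‖ ≤ B := (PiLp.norm_apply_le (f t) i).trans (hB t)
  have hcoord (i : κ) (ω : Ω) : (∑ j ∈ S, compensatedIntegral Λ f (X j ω)) i =
      ∑ j ∈ S, compensatedIntegral Λ (fun t => f t i) (X j ω) := by
    have h := compensatedIntegral_clm_comp Λ (EuclideanSpace.proj (𝕜 := ℝ) i) hf hB
    simpa using Finset.sum_congr rfl fun j _ => (h (X j ω)).symm
  simp only [enorm_sq_eq_sum, hcoord]
  rw [lintegral_finsetSum _ fun i _ => ?_, lintegral_finsetSum _ fun i _ => ?_, Finset.mul_sum]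
  · exact Finset.sum_le_sum fun i _ =>
      lintegral_enorm_sq_sum_compensatedIntegral_le_real hX hindep (hfm i) (hfB i) S
  · exact (hfm i).enorm.pow_const 2
  · exact (Finset.measurable_fun_sum _ fun j _ =>
      (measurable_compensatedIntegral Λ (hfm i)).comp (hX j).measurable).enorm.pow_const 2

lemma lintegral_enorm_sq_sum_compensatedIntegral_le_of_indepFun {E : Type*} [MeasurableSpace E]
    (hX : ∀ j, IsPoissonRandomMeasure P Λ (X j)) (hindep : iIndepFun X P)
    {g : E → α → EuclideanSpace ℝ κ} (hg : Measurable (Function.uncurry g))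
    (hB : ∀ θ t, ‖g θ t‖ ≤ B) {S : Finset ι} {Y : Ω → E} (hY : Measurable Y)
    (hYX : IndepFun Y (fun ω (j : S) => X j ω) P) :
    ∫⁻ ω, ‖∑ j ∈ S, compensatedIntegral Λ (g (Y ω)) (X j ω)‖ₑ ^ 2 ∂P ≤
      2 * S.card * ∫⁻ ω, ∫⁻ t, ‖g (Y ω) t‖ₑ ^ 2 ∂Λ ∂P := by
  have hXS : Measurable fun ω (j : S) => X j ω := measurable_pi_lambda _ fun j => (hX j).measurable
  have : IsProbabilityMeasure (P.map fun ω (j : S) => X j ω) :=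
    Measure.isProbabilityMeasure_map hXS.aemeasurable
  have hH : Measurable fun p : E × (S → Measure α) =>
      ‖∑ j : S, compensatedIntegral Λ (g p.1) (p.2 j)‖ₑ ^ 2 :=
    (Finset.measurable_fun_sum _ fun j _ => (measurable_compensatedIntegral_uncurry Λ hg).comp
      (measurable_fst.prodMk ((measurable_pi_apply j).comp measurable_snd))).enorm.pow_const 2
  have hsum (θ : E) (ω : Ω) : ∑ j ∈ S, compensatedIntegral Λ (g θ) (X j ω) =
      ∑ j : S, compensatedIntegral Λ (g θ) (X j ω) := (Finset.sum_coe_sort S _).symm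
  have hh : Measurable fun θ => ∫⁻ t, ‖g θ t‖ₑ ^ 2 ∂Λ :=
    (hg.enorm.pow_const 2).lintegral_prod_right'
  calc ∫⁻ ω, ‖∑ j ∈ S, compensatedIntegral Λ (g (Y ω)) (X j ω)‖ₑ ^ 2 ∂P
      = ∫⁻ θ, ∫⁻ x, ‖∑ j : S, compensatedIntegral Λ (g θ) (x j)‖ₑ ^ 2
          ∂(P.map fun ω (j : S) => X j ω) ∂(P.map Y) := by
        rw [← lintegral_prod _ hH.aemeasurable,
          ← hYX.map_prod_eq_prod_map_map hY.aemeasurable hXS.aemeasurable,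
          lintegral_map hH (hY.prodMk hXS)]
        simp only [hsum]
    _ ≤ ∫⁻ θ, 2 * S.card * ∫⁻ t, ‖g θ t‖ₑ ^ 2 ∂Λ ∂(P.map Y) := by
        refine lintegral_mono fun θ => ?_
        have hθ := hH.comp (measurable_prodMk_left (x := θ))
        simp only [Function.comp_def] at hθ
        rw [lintegral_map hθ hXS]
        simp only [← hsum]
        exact lintegral_enorm_sq_sum_compensatedIntegral_le hX hindep
          (hg.comp measurable_prodMk_left) (hB θ) S
    _ = 2 * S.card * ∫⁻ ω, ∫⁻ t, ‖g (Y ω) t‖ₑ ^ 2 ∂Λ ∂P := by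
        rw [lintegral_const_mul _ hh, lintegral_map hh hY]

end SecondMoment

theorem tendstoInDistribution_sum_compensatedIntegral [IsProbabilityMeasure P]
    {X : ℕ → Ω → Measure α} (hX : ∀ j, IsPoissonRandomMeasure P Λ (X j)) (hindep : iIndepFun X P)
    {κ : Type*} [Fintype κ] [DecidableEq κ] {f : α → EuclideanSpace ℝ κ} (hf : Measurable f)
    (hB : ∀ t, ‖f t‖ ≤ B) {S : Matrix κ κ ℝ} (hS : S.PosSemidef)
    (hcov : ∀ u : EuclideanSpace ℝ κ, u.ofLp ⬝ᵥ S.mulVec u.ofLp = ∫ t, inner ℝ u (f t) ^ 2 ∂Λ) :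
    TendstoInDistribution (fun (n : ℕ) ω => (√(n : ℝ))⁻¹ • ∑ j ∈ Finset.range n,
      compensatedIntegral Λ f (X j ω)) atTop id (fun _ => P) (multivariateGaussian 0 S) := by
  have hm (n : ℕ) : Measurable fun ω => ∑ j ∈ Finset.range n, compensatedIntegral Λ f (X j ω) :=
    Finset.measurable_fun_sum (Finset.range n) fun j _ =>
      (measurable_compensatedIntegral Λ hf).comp (hX j).measurable
  refine ⟨fun n => ((hm n).fun_const_smul _).aemeasurable, aemeasurable_id,
    ProbabilityMeasure.tendsto_iff_tendsto_charFun.2 fun u => ?_⟩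
  have hfu : Measurable fun t => inner ℝ u (f t) := by fun_prop
  have hBu (t : α) : ‖inner ℝ u (f t)‖ ≤ ‖u‖ * B :=
    (norm_inner_le_norm _ _).trans (by gcongr; exact hB t)
  have hchar (n : ℕ) : charFun (P.map fun ω => (√(n : ℝ))⁻¹ • ∑ j ∈ Finset.range n,
      compensatedIntegral Λ f (X j ω)) u =
        Complex.exp (n * ∫ t, compensatedCexp ((√(n : ℝ))⁻¹ * inner ℝ u (f t)) ∂Λ) := by
    have hmap := Measure.map_map (μ := P) (measurable_const_smul (√(n : ℝ))⁻¹) (hm n)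
    simp only [Function.comp_def] at hmap
    rw [← hmap, charFun_map_smul, charFun_map_sum_compensatedIntegral hX hindep hf hB,
      Finset.card_range]
    simp only [real_inner_smul_left]
  simp only [ProbabilityMeasure.coe_mk, Measure.map_id, hchar]
  rw [charFun_multivariateGaussian hS, hcov u]
  refine (Complex.continuous_exp.tendsto _).comp ?_
  convert! tendsto_natCast_mul_integral_compensatedCexp Λ hfu hBu using 2
  simp

end PoissonRandomMeasure

section PoissonLaw

variable {Ω : Type*} [MeasurableSpace Ω] {P : Measure Ω} [IsProbabilityMeasure P]

lemma map_eq_map_poissonMeasure {Y : Ω → ℝ≥0∞} (hY : Measurable Y) {r : ℝ≥0}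
    (h : ∀ k : ℕ, P {ω | Y ω = k} =
      ENNReal.ofReal (Real.exp (-r) * (r : ℝ) ^ k / (k.factorial : ℝ))) :
    P.map Y = (poissonMeasure r).map (Nat.cast : ℕ → ℝ≥0∞) := by
  have : IsProbabilityMeasure (P.map Y) := Measure.isProbabilityMeasure_map hY.aemeasurable
  have hcast : MeasurableEmbedding (Nat.cast : ℕ → ℝ≥0∞) :=
    ⟨Nat.cast_injective, .of_discrete, fun s _ => (s.to_countable.image _).measurableSet⟩
  have hcomap : poissonMeasure r = (P.map Y).comap (Nat.cast : ℕ → ℝ≥0∞) := by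
    refine Measure.ext_of_singleton fun k => ?_
    rw [hcast.comap_apply, image_singleton, Measure.map_apply hY (measurableSet_singleton _),
      poissonMeasure_singleton]
    exact (h k).symm
  refine (Measure.eq_of_le_of_isProbabilityMeasure ?_).symm
  rw [hcomap, hcast.map_comap]
  exact Measure.restrict_le_self

lemma lintegral_natCast_poissonMeasure (r : ℝ≥0) :
    ∫⁻ k, (k : ℝ≥0∞) ∂(poissonMeasure r) = r := by
  have hs : HasSum (fun n : ℕ => Real.exp (-r) * (r : ℝ) ^ n / (n.factorial : ℝ) * (n : ℝ)) r := by
    rw [← hasSum_nat_add_iff' 1]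
    simp only [Finset.range_one, Finset.sum_singleton, Nat.cast_zero, mul_zero, sub_zero]
    refine (mul_one (r : ℝ) ▸ (hasSum_one_poissonMeasure r).mul_left (r : ℝ)).congr_fun fun n => ?_
    rw [Nat.factorial_succ]
    push_cast
    field_simp
    ring
  rw [lintegral_countable']
  have e (n : ℕ) : (n : ℝ≥0∞) * poissonMeasure r {n} =
      ENNReal.ofReal (Real.exp (-r) * (r : ℝ) ^ n / (n.factorial : ℝ) * (n : ℝ)) := by
    rw [poissonMeasure_singleton, ENNReal.ofReal_mul (by positivity), ENNReal.ofReal_natCast,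
      mul_comm]
  simp only [e]
  rw [← ENNReal.ofReal_tsum_of_nonneg (fun n => by positivity) hs.summable, hs.tsum_eq,
    ENNReal.ofReal_coe_nnreal]

end PoissonLaw

section RiemannSum

/-- The `i`-th point of the grid of mesh `1 / (m + 1)` that starts at `-m`. -/
noncomputable def gridPoint (m i : ℕ) : ℝ := -m + i / (m + 1)

/-- The largest multiple of `1 / (m + 1)` which is strictly smaller than `t`. -/
noncomputable def gridFloor (m : ℕ) (t : ℝ) : ℝ := (⌈(m + 1) * t⌉ - 1) / (m + 1)

lemma monotone_gridPoint (m : ℕ) : Monotone (gridPoint m) := fun i j hij => by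
  unfold gridPoint
  gcongr

lemma gridFloor_eq_of_mem_Ioc {m i : ℕ} {t : ℝ}
    (ht : t ∈ Ioc (gridPoint m i) (gridPoint m (i + 1))) : gridFloor m t = gridPoint m i := by
  have hceil : ⌈((m : ℝ) + 1) * t⌉ = -(m * (m + 1) : ℤ) + i + 1 := by
    have hm : (0 : ℝ) < m + 1 := by positivity
    have hgrid (k : ℕ) : ((m : ℝ) + 1) * gridPoint m k = -(m * (m + 1)) + k := by
      unfold gridPoint
      field_simp
    have hlt := mul_lt_mul_of_pos_left ht.1 hm
    have hle := mul_le_mul_of_nonneg_left ht.2 hm.le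
    rw [hgrid] at hlt hle
    rw [Int.ceil_eq_iff]
    push_cast at hle ⊢
    constructor <;> linarith
  rw [gridFloor, hceil, gridPoint]
  push_cast
  field_simp
  ring

lemma tendsto_gridFloor (t : ℝ) : Tendsto (fun m => gridFloor m t) atTop (𝓝 t) := by
  refine tendsto_of_tendsto_of_tendsto_of_le_of_le (g := fun m : ℕ => t - 1 / ((m : ℝ) + 1))
    (h := fun _ => t) ?_ tendsto_const_nhds (fun m => ?_) fun m => ?_
  · simpa using tendsto_one_div_add_atTop_nhds_zero_nat.const_sub t
  · have hm : (0 : ℝ) < m + 1 := by positivity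
    simp only [gridFloor]
    rw [le_div_iff₀ hm, sub_mul, one_div_mul_cancel hm.ne', mul_comm t]
    gcongr
    exact Int.le_ceil _
  · have hm : (0 : ℝ) < m + 1 := by positivity
    simp only [gridFloor]
    rw [div_le_iff₀ hm, mul_comm t]
    linarith [Int.ceil_lt_add_one (((m : ℝ) + 1) * t)]

lemma measurable_gridFloor (m : ℕ) : Measurable (gridFloor m) := by
  unfold gridFloor
  fun_prop

variable {F : Type*} [NormedAddCommGroup F] [NormedSpace ℝ F] [CompleteSpace F]
  [MeasurableSpace F] [BorelSpace F] [SecondCountableTopology F]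

lemma sum_gridPoint_eq_integral_gridFloor (μ : Measure ℝ) [IsFiniteMeasure μ] {g : ℝ → F}
    (hg : Measurable g) {B : ℝ} (hB : ∀ t, ‖g t‖ ≤ B) (m : ℕ) :
    ∑ i ∈ Finset.range (2 * m * (m + 1)),
        μ.real (Ioc (gridPoint m i) (gridPoint m (i + 1))) • g (gridPoint m i) =
      ∫ t in Ioc (-m : ℝ) m, g (gridFloor m t) ∂μ := by
  have hint : Integrable (fun t => g (gridFloor m t)) μ :=
    integrable_of_measurable_of_bound μ (hg.comp (measurable_gridFloor m)) fun t => hB _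
  have h0 : gridPoint m 0 = -m := by simp [gridPoint]
  have hM : gridPoint m (2 * m * (m + 1)) = m := by
    simp only [gridPoint]
    push_cast
    field_simp
    ring
  have hsum := intervalIntegral.sum_integral_adjacent_intervals (a := gridPoint m)
    (n := 2 * m * (m + 1)) fun k _ => hint.intervalIntegrable
  rw [h0, hM, intervalIntegral.integral_of_le (neg_le_self (Nat.cast_nonneg m))] at hsum
  rw [← hsum]
  refine Finset.sum_congr rfl fun i _ => ?_
  rw [intervalIntegral.integral_of_le (monotone_gridPoint m i.le_succ), ← setIntegral_const]
  exact setIntegral_congr_fun measurableSet_Ioc fun t ht => by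
    simp only [gridFloor_eq_of_mem_Ioc ht]

lemma tendsto_sum_gridPoint (μ : Measure ℝ) [IsFiniteMeasure μ] {g : ℝ → F} (hg : Continuous g)
    {B : ℝ} (hB : ∀ t, ‖g t‖ ≤ B) :
    Tendsto (fun m : ℕ => ∑ i ∈ Finset.range (2 * m * (m + 1)),
      μ.real (Ioc (gridPoint m i) (gridPoint m (i + 1))) • g (gridPoint m i)) atTop
      (𝓝 (∫ t, g t ∂μ)) := by
  simp only [sum_gridPoint_eq_integral_gridFloor μ hg.measurable hB,
    ← integral_indicator measurableSet_Ioc]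
  refine tendsto_integral_of_dominated_convergence (fun _ => B) (fun m => ?_)
    (integrable_const _) (fun m => ae_of_all _ fun t => ?_) (ae_of_all _ fun t => ?_)
  · exact ((hg.measurable.comp (measurable_gridFloor m)).indicator
      measurableSet_Ioc).aestronglyMeasurable
  · exact (norm_indicator_le_norm_self _ _).trans (hB _)
  · refine Tendsto.congr' ?_ ((hg.tendsto t).comp (tendsto_gridFloor t))
    filter_upwards [tendsto_natCast_atTop_atTop.eventually_gt_atTop |t|] with m hm
    rw [indicator_of_mem (mem_Ioc.2 ⟨(abs_lt.1 hm).1, (abs_lt.1 hm).2.le⟩), Function.comp_apply]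

end RiemannSum

lemma tendsto_of_enorm_sub_le {ι E : Type*} [SeminormedAddCommGroup E] {l : Filter ι} {u : ι → E}
    {a : E} {b : ι → ℝ≥0∞} (hle : ∀ i, ‖u i - a‖ₑ ≤ b i) (hb : Tendsto b l (𝓝 0)) :
    Tendsto u l (𝓝 a) :=
  tendsto_iff_edist_tendsto_0.2 <| tendsto_of_tendsto_of_tendsto_of_le_of_le tendsto_const_nhds hb
    (fun _ => zero_le) fun i => (edist_eq_enorm_sub _ _).trans_le (hle i)

section PoissonIncrements

variable {Ω : Type*} [MeasurableSpace Ω] {P : Measure Ω} {Λ : Measure ℝ} {X : Ω → Measure ℝ}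

/-- The random measure `X` on `ℝ` has independent increments, and the increment over `(s, t]` is
Poisson distributed with mean `Λ (s, t]`. -/
structure HasPoissonIncrements (P : Measure Ω) (Λ : Measure ℝ) (X : Ω → Measure ℝ) : Prop where
  measurable : Measurable X
  map_Ioc : ∀ s t : ℝ, s < t → P.map (fun ω => X ω (Ioc s t)) =
    (poissonMeasure (Λ (Ioc s t)).toNNReal).map (Nat.cast : ℕ → ℝ≥0∞)
  iIndepFun_Ioc : ∀ t : ℕ → ℝ, Monotone t →
    iIndepFun (fun (i : ℕ) ω => X ω (Ioc (t i) (t (i + 1)))) P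

namespace HasPoissonIncrements

lemma measurable_apply (hX : HasPoissonIncrements P Λ X) {A : Set ℝ} (hA : MeasurableSet A) :
    Measurable fun ω => X ω A :=
  (Measure.measurable_coe hA).comp hX.measurable

section MeanMeasure

variable [IsFiniteMeasure Λ]

lemma bind_eq (hX : HasPoissonIncrements P Λ X) : P.bind X = Λ := by
  refine (Measure.ext_of_Ioc _ _ fun a b hab => ?_).symm
  rw [Measure.bind_apply measurableSet_Ioc hX.measurable.aemeasurable,
    ← lintegral_map (f := fun y => y) measurable_id (hX.measurable_apply measurableSet_Ioc),
    hX.map_Ioc a b hab, lintegral_map (f := fun y => y) measurable_id .of_discrete,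
    lintegral_natCast_poissonMeasure, ENNReal.coe_toNNReal (measure_ne_top _ _)]

lemma ae_lt_top (hX : HasPoissonIncrements P Λ X) : ∀ᵐ ω ∂P, X ω univ < ∞ := by
  refine MeasureTheory.ae_lt_top (hX.measurable_apply MeasurableSet.univ) ?_
  rw [← Measure.bind_apply MeasurableSet.univ hX.measurable.aemeasurable, hX.bind_eq]
  exact measure_ne_top _ _

lemma lintegral_lintegral_finitePart (hX : HasPoissonIncrements P Λ X) {f : ℝ → ℝ≥0∞}
    (hf : Measurable f) : ∫⁻ ω, ∫⁻ t, f t ∂(finitePart (X ω)) ∂P = ∫⁻ t, f t ∂Λ := by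
  rw [← hX.bind_eq, Measure.lintegral_bind hX.measurable.aemeasurable hf.aemeasurable]
  exact lintegral_congr_ae (hX.ae_lt_top.mono fun ω h => by simp only [finitePart_of_lt_top h])

end MeanMeasure

variable [IsProbabilityMeasure P]

lemma integral_cexp_Ioc (hX : HasPoissonIncrements P Λ X) {s t : ℝ} (hst : s ≤ t) (u : ℝ) :
    ∫ ω, Complex.exp (((X ω).real (Ioc s t) * u : ℝ) * Complex.I) ∂P =
      Complex.exp (Λ.real (Ioc s t) * (Complex.exp (u * Complex.I) - 1)) := by
  rcases hst.eq_or_lt with rfl | hst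
  · simp
  have hchar := charFun_map_cast_poissonMeasure (Λ (Ioc s t)).toNNReal u
  rw [charFun_apply, integral_map .of_discrete (by fun_prop)] at hchar
  simp only [Real.inner_apply] at hchar
  calc ∫ ω, Complex.exp (((X ω).real (Ioc s t) * u : ℝ) * Complex.I) ∂P
      = ∫ y, Complex.exp ((y.toReal * u : ℝ) * Complex.I) ∂(P.map fun ω => X ω (Ioc s t)) := by
        rw [integral_map (hX.measurable_apply measurableSet_Ioc).aemeasurable
          (Measurable.aestronglyMeasurable (by fun_prop))]
        rfl
    _ = ∫ k : ℕ, Complex.exp (((k : ℝ) * u : ℝ) * Complex.I)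
          ∂(poissonMeasure (Λ (Ioc s t)).toNNReal) := by
        rw [hX.map_Ioc s t hst, integral_map .of_discrete
          (Measurable.aestronglyMeasurable (by fun_prop))]
        simp only [ENNReal.toReal_natCast]
    _ = Complex.exp (Λ.real (Ioc s t) * (Complex.exp (u * Complex.I) - 1)) := hchar

lemma integral_cexp_sum (hX : HasPoissonIncrements P Λ X) {t : ℕ → ℝ} (ht : Monotone t)
    (c : ℕ → ℝ) (M : ℕ) :
    ∫ ω, Complex.exp ((∑ i ∈ Finset.range M,
        (X ω).real (Ioc (t i) (t (i + 1))) * c i : ℝ) * Complex.I) ∂P =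
      Complex.exp (∑ i ∈ Finset.range M, Λ.real (Ioc (t i) (t (i + 1))) *
        (Complex.exp (c i * Complex.I) - 1)) := by
  have hm (i : ℕ) : Measurable fun ω => (X ω).real (Ioc (t i) (t (i + 1))) * c i :=
    (hX.measurable_apply measurableSet_Ioc).ennreal_toReal.mul_const _
  have hind : iIndepFun (fun (i : ℕ) ω => (X ω).real (Ioc (t i) (t (i + 1))) * c i) P :=
    (hX.iIndepFun_Ioc t ht).comp (fun i y => y.toReal * c i) fun _ => by fun_prop
  have h := congrFun ((hind.restrict _).charFun_map_fun_finsetSum_eq_prod (s := Finset.range M)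
    fun i _ => (hm i).aemeasurable) 1
  rw [charFun_apply, integral_map (Finset.measurable_fun_sum _ fun i _ => hm i).aemeasurable
    (by fun_prop), Finset.prod_apply] at h
  simp only [Real.inner_apply, mul_one] at h
  rw [h, Complex.exp_sum]
  refine Finset.prod_congr rfl fun i _ => ?_
  rw [charFun_apply, integral_map (hm i).aemeasurable (by fun_prop)]
  simpa using hX.integral_cexp_Ioc (ht (Nat.le_succ i)) (c i)

variable [IsFiniteMeasure Λ]

lemma integral_cexp_of_continuous (hX : HasPoissonIncrements P Λ X) {g : ℝ → ℝ}
    (hg : Continuous g) {B : ℝ} (hB : ∀ t, ‖g t‖ ≤ B) :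
    ∫ ω, Complex.exp ((∫ t, g t ∂(finitePart (X ω)) : ℝ) * Complex.I) ∂P =
      Complex.exp (∫ t, (Complex.exp (g t * Complex.I) - 1) ∂Λ) := by
  refine tendsto_nhds_unique (f := fun m : ℕ => ∫ ω, Complex.exp ((∑ i ∈ Finset.range
    (2 * m * (m + 1)), (X ω).real (Ioc (gridPoint m i) (gridPoint m (i + 1))) *
      g (gridPoint m i) : ℝ) * Complex.I) ∂P) (l := atTop) ?_ ?_
  · refine tendsto_integral_of_dominated_convergence (fun _ => 1) (fun m => ?_)
      (integrable_const _) (fun m => ae_of_all _ fun ω => (Complex.norm_exp_ofReal_mul_I _).le) ?_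
    · have := Finset.measurable_fun_sum (Finset.range (2 * m * (m + 1))) fun i _ =>
        (hX.measurable_apply (measurableSet_Ioc (a := gridPoint m i)
          (b := gridPoint m (i + 1)))).ennreal_toReal.mul_const (g (gridPoint m i))
      exact (integrable_cexp_mul_I P this).aestronglyMeasurable
    · filter_upwards [hX.ae_lt_top] with ω hω
      have h := tendsto_sum_gridPoint (finitePart (X ω)) hg hB
      simp only [finitePart_of_lt_top hω, smul_eq_mul] at h ⊢
      exact ((Complex.continuous_exp.comp (by fun_prop : Continuous fun x : ℝ =>
        (x : ℂ) * Complex.I)).tendsto _).comp h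
  · simp only [hX.integral_cexp_sum (monotone_gridPoint _)]
    have hB' (t : ℝ) : ‖Complex.exp (g t * Complex.I) - 1‖ ≤ 1 + 1 :=
      (norm_sub_le _ _).trans (by simp [Complex.norm_exp_ofReal_mul_I])
    have h := tendsto_sum_gridPoint Λ (g := fun t => Complex.exp (g t * Complex.I) - 1)
      (by fun_prop) hB'
    simp only [Complex.real_smul] at h
    exact (Complex.continuous_exp.tendsto _).comp h

lemma enorm_integral_cexp_finitePart_sub_le (hX : HasPoissonIncrements P Λ X) {f g : ℝ → ℝ}
    {A B : ℝ} (hf : Measurable f) (hg : Measurable g) (hfA : ∀ t, ‖f t‖ ≤ A)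
    (hgB : ∀ t, ‖g t‖ ≤ B) :
    ‖∫ ω, Complex.exp ((∫ t, f t ∂(finitePart (X ω)) : ℝ) * Complex.I) ∂P -
      ∫ ω, Complex.exp ((∫ t, g t ∂(finitePart (X ω)) : ℝ) * Complex.I) ∂P‖ₑ ≤
        ∫⁻ t, ‖f t - g t‖ₑ ∂Λ := by
  have hm {h : ℝ → ℝ} (hh : Measurable h) : Measurable fun ω => ∫ t, h t ∂(finitePart (X ω)) :=
    (hh.comp measurable_snd).stronglyMeasurable.integral_kernel_prod_right' (κ := finitePart)
      |>.measurable.comp hX.measurable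
  refine (enorm_integral_cexp_sub_integral_cexp_le P (hm hf) (hm hg)).trans ?_
  rw [← hX.lintegral_lintegral_finitePart (f := fun t => ‖f t - g t‖ₑ) (hf.sub hg).enorm]
  refine lintegral_mono fun ω => ?_
  rw [← integral_sub (integrable_of_measurable_of_bound _ hf hfA)
    (integrable_of_measurable_of_bound _ hg hgB)]
  exact enorm_integral_le_lintegral_enorm _

lemma isPoissonRandomMeasure (hX : HasPoissonIncrements P Λ X) :
    IsPoissonRandomMeasure P Λ X := by
  refine ⟨hX.measurable, hX.ae_lt_top, fun {f B} hf hB => ?_⟩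
  have hi := integrable_of_measurable_of_bound Λ hf hB
  choose g hgε hgi using fun k : ℕ =>
    hi.exists_boundedContinuous_integral_sub_le
      (Nat.one_div_pos_of_nat (α := ℝ) (n := k))
  have hε : Tendsto (fun k => ∫⁻ t, ‖g k t - f t‖ₑ ∂Λ) atTop (𝓝 0) := by
    refine tendsto_of_tendsto_of_tendsto_of_le_of_le tendsto_const_nhds
      (ENNReal.tendsto_ofReal tendsto_one_div_add_atTop_nhds_zero_nat |>.trans_eq (by simp))
      (fun _ => zero_le) fun k => le_trans (le_of_eq ?_) (ENNReal.ofReal_le_ofReal (hgε k))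
    rw [ofReal_integral_norm_eq_lintegral_enorm (f := fun t => f t - g k t) (hi.sub (hgi k))]
    exact lintegral_congr fun t => enorm_sub_rev _ _
  have hP : Tendsto (fun k => ∫ ω, Complex.exp ((∫ t, g k t ∂(finitePart (X ω)) : ℝ) * Complex.I)
      ∂P) atTop
      (𝓝 (∫ ω, Complex.exp ((∫ t, f t ∂(finitePart (X ω)) : ℝ) * Complex.I) ∂P)) :=
    tendsto_of_enorm_sub_le (fun k => hX.enorm_integral_cexp_finitePart_sub_le
      (g k).continuous.measurable hf (g k).norm_coe_le_norm hB) hε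
  have hΛ : Tendsto (fun k => ∫ t, (Complex.exp (g k t * Complex.I) - 1) ∂Λ) atTop
      (𝓝 (∫ t, (Complex.exp (f t * Complex.I) - 1) ∂Λ)) := by
    simp only [integral_sub (integrable_cexp_mul_I Λ (g _).continuous.measurable)
      (integrable_const (1 : ℂ)),
      integral_sub (integrable_cexp_mul_I Λ hf) (integrable_const (1 : ℂ))]
    exact (tendsto_of_enorm_sub_le (fun k => enorm_integral_cexp_sub_integral_cexp_le Λ
      (g k).continuous.measurable hf) hε).sub_const _
  rw [integral_congr_ae (g := fun ω =>
    Complex.exp ((∫ t, f t ∂(finitePart (X ω)) : ℝ) * Complex.I))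
      (hX.ae_lt_top.mono fun ω h => by simp only [finitePart_of_lt_top h])]
  simp only [hX.integral_cexp_of_continuous (g _).continuous (g _).norm_coe_le_norm] at hP
  exact tendsto_nhds_unique hP ((Complex.continuous_exp.tendsto _).comp hΛ)

end HasPoissonIncrements

end PoissonIncrements

section PoissonProcess

/-- The intensity measure on `T` with density `lam`. -/
noncomputable def intensityMeasure (T : Set ℝ) (lam : ℝ → ℝ) : Measure ℝ :=
  (volume.restrict T).withDensity fun t => ENNReal.ofReal (lam t)

variable {T : Set ℝ} {lam : ℝ → ℝ}

lemma isFiniteMeasure_intensityMeasure (h : IntegrableOn lam T) :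
    IsFiniteMeasure (intensityMeasure T lam) :=
  isFiniteMeasure_withDensity_ofReal h.2

lemma intensityMeasure_apply (hT : MeasurableSet T) (h : IntegrableOn lam T)
    (hpos : ∀ t ∈ T, 0 ≤ lam t) {A : Set ℝ} (hA : MeasurableSet A) :
    intensityMeasure T lam A = ENNReal.ofReal (∫ u in T ∩ A, lam u) := by
  rw [intensityMeasure, withDensity_apply _ hA, Measure.restrict_restrict hA, inter_comm,
    ofReal_integral_eq_lintegral_ofReal (h.mono_set inter_subset_left)]
  exact (ae_restrict_mem (hT.inter hA)).mono fun t ht => hpos t ht.1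

variable {Ω : Type*} [MeasurableSpace Ω] {P : Measure Ω} {X : Ω → Measure ℝ}

lemma IsPoissonProcess.hasPoissonIncrements [IsProbabilityMeasure P]
    (hX : IsPoissonProcess P T lam X) (hT : MeasurableSet T) (hint : IntegrableOn lam T)
    (hpos : ∀ t ∈ T, 0 ≤ lam t) : HasPoissonIncrements P (intensityMeasure T lam) X := by
  have hcarried (ω : Ω) (A : Set ℝ) : X ω (T ∩ A) = X ω A := by
    rw [inter_comm]
    exact measure_inter_conull (hX.carried ω)
  refine ⟨hX.measurable, fun s t hst => ?_, by simpa only [hcarried] using hX.indep_increments⟩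
  refine map_eq_map_poissonMeasure
    ((Measure.measurable_coe measurableSet_Ioc).comp hX.measurable) fun k => ?_
  have h0 : 0 ≤ ∫ u in T ∩ Ioc s t, lam u :=
    setIntegral_nonneg (hT.inter measurableSet_Ioc) fun u hu => hpos u hu.1
  rw [intensityMeasure_apply hT hint hpos measurableSet_Ioc, ENNReal.coe_toNNReal_eq_toReal,
    ENNReal.toReal_ofReal h0, ← hX.increment_law s t hst k]
  simp only [hcarried, Function.comp_apply]

end PoissonProcess

section ConvergenceInProbability

variable {Ω : Type*} [MeasurableSpace Ω] {P : Measure Ω} {F : Type*} [SeminormedAddCommGroup F]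

/-- The sequence `Y n` is bounded in probability, `Y n = O_P(1)`. -/
def BoundedInProbability (P : Measure Ω) (Y : ℕ → Ω → F) : Prop :=
  ∀ ε : ℝ, 0 < ε → ∃ M : ℝ, ∀ n, P {ω | M < ‖Y n ω‖} ≤ ENNReal.ofReal ε

lemma BoundedInProbability.tendstoInMeasure_mul_norm_pow {Y : ℕ → Ω → F}
    (hY : BoundedInProbability P Y) {s : ℕ → ℝ} (hs : Tendsto s atTop (𝓝 0)) (p : ℕ) :
    TendstoInMeasure P (fun n ω => s n * ‖Y n ω‖ ^ p) atTop 0 := by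
  rw [tendstoInMeasure_iff_norm]
  intro ε hε
  rw [ENNReal.tendsto_nhds_zero]
  intro η hη
  obtain ⟨r, hr0, hr⟩ := ENNReal.lt_iff_exists_nnreal_btwn.1 hη
  obtain ⟨M, hM⟩ := hY r (by exact_mod_cast hr0)
  have hlim : Tendsto (fun n => |s n| * |M| ^ p) atTop (𝓝 0) := by
    simpa using hs.abs.mul_const (|M| ^ p)
  filter_upwards [hlim.eventually_lt_const hε] with n hn
  refine (measure_mono fun ω hω => ?_).trans ((hM n).trans (by simpa using hr.le))
  have hω : ε ≤ |s n| * ‖Y n ω‖ ^ p := by simpa [abs_mul] using hω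
  change M < ‖Y n ω‖
  by_contra! hle
  have : ‖Y n ω‖ ^ p ≤ |M| ^ p := by
    gcongr
    exact hle.trans (le_abs_self M)
  exact hω.not_gt ((mul_le_mul_of_nonneg_left this (abs_nonneg _)).trans_lt hn)

lemma tendstoInMeasure_zero_of_norm_le {G : Type*} [SeminormedAddCommGroup G]
    {Z : ℕ → Ω → F} {R : ℕ → Ω → G} (hR : TendstoInMeasure P R atTop 0) {A : ℕ → Set Ω}
    (hA : Tendsto (fun n => P (A n)ᶜ) atTop (𝓝 0))
    (hZR : ∀ᶠ n in atTop, ∀ᵐ ω ∂P, ω ∈ A n → ‖Z n ω‖ ≤ ‖R n ω‖) :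
    TendstoInMeasure P Z atTop 0 := by
  rw [tendstoInMeasure_iff_norm] at hR ⊢
  intro ε hε
  have hlim : Tendsto (fun n => P (A n)ᶜ + P {ω | ε ≤ ‖R n ω - (0 : Ω → G) ω‖}) atTop (𝓝 0) := by
    simpa using hA.add (hR ε hε)
  refine tendsto_of_tendsto_of_tendsto_of_le_of_le' tendsto_const_nhds hlim
    (Eventually.of_forall fun _ => zero_le) ?_
  filter_upwards [hZR] with n hn
  refine (measure_mono_ae ?_).trans (measure_union_le _ _)
  filter_upwards [hn] with ω hω hZ
  refine (em (ω ∈ A n)).symm.imp id fun hA => ?_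
  have hZ : ε ≤ ‖Z n ω - 0‖ := hZ
  rw [sub_zero] at hZ
  simpa using hZ.trans (hω hA)

lemma tendstoInMeasure_zero_add {Y Z : ℕ → Ω → F} (hY : TendstoInMeasure P Y atTop 0)
    (hZ : TendstoInMeasure P Z atTop 0) :
    TendstoInMeasure P (fun n ω => Y n ω + Z n ω) atTop 0 := by
  rw [tendstoInMeasure_iff_norm] at hY hZ ⊢
  intro ε hε
  refine tendsto_of_tendsto_of_tendsto_of_le_of_le tendsto_const_nhds
    (by simpa using (hY (ε / 2) (half_pos hε)).add (hZ (ε / 2) (half_pos hε)))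
    (fun _ => zero_le) fun n => (measure_mono fun ω hω => ?_).trans (measure_union_le _ _)
  have hω : ε ≤ ‖Y n ω + Z n ω‖ := by simpa using hω
  have h : ε / 2 ≤ ‖Y n ω‖ ∨ ε / 2 ≤ ‖Z n ω‖ := by
    by_contra! h
    linarith [norm_add_le (Y n ω) (Z n ω)]
  simpa using h

lemma tendstoInMeasure_zero_of_lintegral_enorm_sq {F : Type*} [NormedAddCommGroup F]
    {Y : ℕ → Ω → F} (hY : ∀ n, AEStronglyMeasurable (Y n) P)
    (h : Tendsto (fun n => ∫⁻ ω, ‖Y n ω‖ₑ ^ 2 ∂P) atTop (𝓝 0)) :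
    TendstoInMeasure P Y atTop 0 := by
  refine tendstoInMeasure_of_tendsto_eLpNorm (p := 2) two_ne_zero hY
    aestronglyMeasurable_zero ?_
  have hroot := h.ennrpow_const (1 / 2)
  simpa [eLpNorm_eq_lintegral_rpow_enorm_toReal] using hroot

lemma tendsto_lintegral_comp_of_tendstoInMeasure_const [IsFiniteMeasure P] {E : Type*}
    [PseudoEMetricSpace E] [MeasurableSpace E] {Y : ℕ → Ω → E} (hY : ∀ n, Measurable (Y n))
    {y : E} (hlim : TendstoInMeasure P Y atTop fun _ => y) {h : E → ℝ≥0∞} (hm : Measurable h)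
    {C : ℝ≥0∞} (hC : C ≠ ∞) (hhC : ∀ z, h z ≤ C) (hh : Tendsto h (𝓝 y) (𝓝 0)) :
    Tendsto (fun n => ∫⁻ ω, h (Y n ω) ∂P) atTop (𝓝 0) := by
  refine tendsto_of_subseq_tendsto fun ns hns => ?_
  obtain ⟨ms, -, hms⟩ := (hlim.comp hns).exists_seq_tendsto_ae
  refine ⟨ms, ?_⟩
  have hdom := tendsto_lintegral_of_dominated_convergence (μ := P) (f := fun _ => 0)
    (F := fun n ω => h (Y (ns (ms n)) ω)) (fun _ => C) (fun n => hm.comp (hY _))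
    (fun n => ae_of_all _ fun ω => hhC _) (by simpa using ENNReal.mul_ne_top hC (by finiteness))
    (hms.mono fun ω hω => hh.comp hω)
  simpa using hdom

end ConvergenceInProbability

section OneStep

open Asymptotics

variable {Ω α : Type*} [MeasurableSpace Ω] [MeasurableSpace α] {P : Measure Ω}

section Bias

variable {E : Type*} [NormedAddCommGroup E] [NormedSpace ℝ E] {N : ℕ → ℕ} {U : ℕ → Ω → E}
  {θ₀ : E}

lemma tendstoInMeasure_of_boundedInProbability_sqrt_smul (hN : Tendsto N atTop atTop)
    (hU : BoundedInProbability P fun n ω => √(N n : ℝ) • (U n ω - θ₀)) :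
    TendstoInMeasure P U atTop fun _ => θ₀ := by
  have hs : Tendsto (fun n => (√(N n : ℝ))⁻¹) atTop (𝓝 0) :=
    tendsto_inv_atTop_zero.comp
      (Real.tendsto_sqrt_atTop.comp (tendsto_natCast_atTop_atTop.comp hN))
  have hlim : TendstoInMeasure P (fun n ω => U n ω - θ₀) atTop 0 := by
    refine tendstoInMeasure_zero_of_norm_le (A := fun _ => univ)
      (hU.tendstoInMeasure_mul_norm_pow hs 1) (by simp) ?_
    filter_upwards [hN.eventually_ge_atTop 1] with n hn
    refine ae_of_all _ fun ω _ => le_of_eq ?_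
    have hn0 : √(N n : ℝ) ≠ 0 := by positivity
    rw [pow_one, norm_smul, ← mul_assoc, Real.norm_of_nonneg (Real.sqrt_nonneg _),
      inv_mul_cancel₀ hn0, one_mul, norm_norm]
  rw [tendstoInMeasure_iff_norm] at hlim ⊢
  simpa using hlim

lemma norm_sqrt_smul_sub_add_smul_le {n m : ℕ} (hm : 0 < m) (hmn : m ≤ n) {θ b : E} {K : ℝ}
    (hb : ‖b - (θ₀ - θ)‖ ≤ K * ‖θ - θ₀‖ ^ 2) :
    ‖√(n : ℝ) • (θ - θ₀) + (((n : ℝ) - m) / √n) • b‖ ≤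
      √((m : ℝ) / n) * ‖√(m : ℝ) • (θ - θ₀)‖ ^ 1 +
        K * (√(n : ℝ) / m) * ‖√(m : ℝ) • (θ - θ₀)‖ ^ 2 := by
  have hm0 : (0 : ℝ) < m := by exact_mod_cast hm
  have hmn' : (m : ℝ) ≤ n := by exact_mod_cast hmn
  have hn0 : (0 : ℝ) < n := hm0.trans_le hmn'
  have hnsq : √(n : ℝ) ^ 2 = n := Real.sq_sqrt hn0.le
  have hmsq : √(m : ℝ) ^ 2 = m := Real.sq_sqrt hm0.le
  have hsplit : √(n : ℝ) • (θ - θ₀) + (((n : ℝ) - m) / √n) • b =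
      (m / √n) • (θ - θ₀) + (((n : ℝ) - m) / √n) • (b - (θ₀ - θ)) := by
    match_scalars <;> field_simp <;> rw [hnsq] <;> ring
  have hfirst : ‖(m / √(n : ℝ)) • (θ - θ₀)‖ = √((m : ℝ) / n) * ‖√(m : ℝ) • (θ - θ₀)‖ ^ 1 := by
    rw [norm_smul, norm_smul, Real.norm_of_nonneg (by positivity),
      Real.norm_of_nonneg (Real.sqrt_nonneg _), Real.sqrt_div hm0.le]
    nth_rewrite 1 [← hmsq]
    ring
  have hsecond : ‖(((n : ℝ) - m) / √n) • (b - (θ₀ - θ))‖ ≤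
      K * (√(n : ℝ) / m) * ‖√(m : ℝ) • (θ - θ₀)‖ ^ 2 :=
    calc ‖(((n : ℝ) - m) / √n) • (b - (θ₀ - θ))‖
        = ((n : ℝ) - m) / √n * ‖b - (θ₀ - θ)‖ := by
          rw [norm_smul, Real.norm_of_nonneg (div_nonneg (sub_nonneg.2 hmn') (Real.sqrt_nonneg _))]
      _ ≤ √(n : ℝ) * (K * ‖θ - θ₀‖ ^ 2) := by
          gcongr
          rw [div_le_iff₀ (by positivity), ← sq, hnsq]
          exact sub_le_self _ hm0.le
      _ = K * (√(n : ℝ) / m) * ‖√(m : ℝ) • (θ - θ₀)‖ ^ 2 := by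
          rw [norm_smul, mul_pow, Real.norm_of_nonneg (Real.sqrt_nonneg _), hmsq]
          field_simp
  rw [hsplit, ← hfirst]
  exact (norm_add_le _ _).trans (add_le_add_right hsecond _)

lemma eventually_le_of_tendsto_div (hdiv : Tendsto (fun n => (N n : ℝ) / n) atTop (𝓝 0)) :
    ∀ᶠ n in atTop, N n ≤ n := by
  filter_upwards [hdiv.eventually_lt_const one_pos, eventually_gt_atTop 0] with n hn hn0
  rw [div_lt_one (by exact_mod_cast hn0)] at hn
  exact_mod_cast hn.le

lemma tendstoInMeasure_sqrt_smul_sub_add_smul (hN : Tendsto N atTop atTop)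
    (hdiv : Tendsto (fun n => (N n : ℝ) / n) atTop (𝓝 0))
    (hsqrt : Tendsto (fun n : ℕ => √(n : ℝ) / N n) atTop (𝓝 0))
    (hU : BoundedInProbability P fun n ω => √(N n : ℝ) • (U n ω - θ₀)) {b : E → E}
    (hb : (fun θ => b θ - (θ₀ - θ)) =O[𝓝 θ₀] fun θ => ‖θ - θ₀‖ ^ 2) :
    TendstoInMeasure P
      (fun (n : ℕ) ω => √(n : ℝ) • (U n ω - θ₀) + (((n : ℝ) - N n) / √n) • b (U n ω)) atTop 0 := by
  obtain ⟨K, hK⟩ := hb.bound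
  obtain ⟨r, hr, hrK⟩ := Metric.eventually_nhds_iff.1 hK
  have hcons := tendstoInMeasure_iff_dist.1
    (tendstoInMeasure_of_boundedInProbability_sqrt_smul hN hU) r hr
  have hR := tendstoInMeasure_zero_add
    (hU.tendstoInMeasure_mul_norm_pow (s := fun n => √((N n : ℝ) / n))
      (by simpa using hdiv.sqrt) 1)
    (hU.tendstoInMeasure_mul_norm_pow (s := fun n => K * (√(n : ℝ) / N n))
      (by simpa using hsqrt.const_mul K) 2)
  refine tendstoInMeasure_zero_of_norm_le (A := fun n => {ω | dist (U n ω) θ₀ < r}) hR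
    (by simpa only [compl_ofPred, not_lt] using hcons) ?_
  filter_upwards [hN.eventually_ge_atTop 1, eventually_le_of_tendsto_div hdiv] with n hn hNn
  refine ae_of_all _ fun ω hω => le_trans ?_ (Real.le_norm_self _)
  exact norm_sqrt_smul_sub_add_smul_le hn hNn (by simpa using hrK hω)

lemma sqrt_smul_oneStep_sub_eq {n m : ℕ} (hn : 0 < n) (hmn : m ≤ n) (θ b : E) (a c : ℕ → E) :
    √(n : ℝ) • (θ + (n : ℝ)⁻¹ • ∑ j ∈ Finset.Ico m n, (a j + b) - θ₀) -
        (√(n : ℝ))⁻¹ • ∑ j ∈ Finset.range n, c j =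
      √(n : ℝ) • (θ - θ₀) + (((n : ℝ) - m) / √n) • b +
        (√(n : ℝ))⁻¹ • ∑ j ∈ Finset.Ico m n, (a j - c j) +
        (√(n : ℝ))⁻¹ • ∑ j ∈ Finset.range m, -c j := by
  have hn0 : (0 : ℝ) < n := by exact_mod_cast hn
  have hnsq : √(n : ℝ) ^ 2 = n := Real.sq_sqrt hn0.le
  have hb : ∑ _j ∈ Finset.Ico m n, b = ((n : ℝ) - m) • b := by
    rw [Finset.sum_const, Nat.card_Ico, ← Nat.cast_smul_eq_nsmul ℝ, Nat.cast_sub hmn]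
  rw [← Finset.sum_range_add_sum_Ico c hmn, Finset.sum_add_distrib, Finset.sum_sub_distrib,
    Finset.sum_neg_distrib, hb]
  match_scalars <;> field_simp <;> simp only [hnsq]

end Bias

lemma lintegral_enorm_sq_le_of_bound {F : Type*} [NormedAddCommGroup F] (μ : Measure α) {f : α → F}
    {B : ℝ} (hB : ∀ t, ‖f t‖ ≤ B) : ∫⁻ t, ‖f t‖ₑ ^ 2 ∂μ ≤ ENNReal.ofReal B ^ 2 * μ univ := by
  rw [← lintegral_const]
  refine lintegral_mono fun t => ?_
  rw [← ofReal_norm]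
  gcongr
  exact hB t

lemma lintegral_enorm_sq_inv_sqrt_smul_le {F : Type*} [NormedAddCommGroup F] [NormedSpace ℝ F]
    {Y : Ω → F} {m : ℕ} {I : ℝ≥0∞} (hY : ∫⁻ ω, ‖Y ω‖ₑ ^ 2 ∂P ≤ 2 * m * I) (n : ℕ) :
    ∫⁻ ω, ‖(√(n : ℝ))⁻¹ • Y ω‖ₑ ^ 2 ∂P ≤ ENNReal.ofReal ((m : ℝ) / n) * (2 * I) := by
  have hsq (ω : Ω) : ‖(√(n : ℝ))⁻¹ • Y ω‖ₑ ^ 2 = ENNReal.ofReal (n : ℝ)⁻¹ * ‖Y ω‖ₑ ^ 2 := by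
    rw [enorm_smul, mul_pow, Real.enorm_eq_ofReal (by positivity),
      ← ENNReal.ofReal_pow (by positivity), inv_pow, Real.sq_sqrt (Nat.cast_nonneg n)]
  calc ∫⁻ ω, ‖(√(n : ℝ))⁻¹ • Y ω‖ₑ ^ 2 ∂P
      = ENNReal.ofReal (n : ℝ)⁻¹ * ∫⁻ ω, ‖Y ω‖ₑ ^ 2 ∂P := by
        simp only [hsq, lintegral_const_mul' _ _ ENNReal.ofReal_ne_top]
    _ ≤ ENNReal.ofReal (n : ℝ)⁻¹ * (2 * m * I) := by gcongr
    _ = ENNReal.ofReal ((m : ℝ) / n) * (2 * I) := by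
        rw [div_eq_inv_mul, ENNReal.ofReal_mul (by positivity), ENNReal.ofReal_natCast]
        ring

variable [IsProbabilityMeasure P] {Λ : Measure α} [IsFiniteMeasure Λ] {X : ℕ → Ω → Measure α}
  {κ : Type*} [Fintype κ]

lemma tendstoInMeasure_inv_sqrt_smul_sum_compensatedIntegral
    (hX : ∀ j, IsPoissonRandomMeasure P Λ (X j)) (hindep : iIndepFun X P)
    {f : α → EuclideanSpace ℝ κ} (hf : Measurable f) {B : ℝ} (hB : ∀ t, ‖f t‖ ≤ B)
    {S : ℕ → Finset ℕ} (hS : Tendsto (fun n => ((S n).card : ℝ) / n) atTop (𝓝 0)) :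
    TendstoInMeasure P (fun (n : ℕ) ω => (√(n : ℝ))⁻¹ • ∑ j ∈ S n, compensatedIntegral Λ f (X j ω))
      atTop 0 := by
  have hm (n : ℕ) : Measurable fun ω => ∑ j ∈ S n, compensatedIntegral Λ f (X j ω) :=
    Finset.measurable_fun_sum (S n) fun j _ =>
      (measurable_compensatedIntegral Λ hf).comp (hX j).measurable
  refine tendstoInMeasure_zero_of_lintegral_enorm_sq
    (fun n => ((hm n).fun_const_smul _).aestronglyMeasurable) ?_
  have hI : ∫⁻ t, ‖f t‖ₑ ^ 2 ∂Λ ≠ ∞ :=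
    ne_top_of_le_ne_top (by finiteness) (lintegral_enorm_sq_le_of_bound Λ hB)
  have hlim : Tendsto (fun n => ENNReal.ofReal (((S n).card : ℝ) / n) *
      (2 * ∫⁻ t, ‖f t‖ₑ ^ 2 ∂Λ)) atTop (𝓝 0) := by
    simpa using ENNReal.Tendsto.mul_const (ENNReal.tendsto_ofReal hS)
      (Or.inr (ENNReal.mul_ne_top ENNReal.ofNat_ne_top hI))
  exact tendsto_of_tendsto_of_tendsto_of_le_of_le tendsto_const_nhds hlim
    (fun _ => zero_le) fun n => lintegral_enorm_sq_inv_sqrt_smul_le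
      (lintegral_enorm_sq_sum_compensatedIntegral_le hX hindep hf hB (S n)) n

lemma tendstoInMeasure_inv_sqrt_smul_sum_compensatedIntegral_sub
    (hX : ∀ j, IsPoissonRandomMeasure P Λ (X j)) (hindep : iIndepFun X P)
    {E : Type*} [PseudoEMetricSpace E] [MeasurableSpace E]
    {f : E → α → EuclideanSpace ℝ κ} (hf : Measurable (Function.uncurry f)) {B : ℝ}
    (hB : ∀ θ t, ‖f θ t‖ ≤ B) {θ₀ : E}
    (hcont : Tendsto (fun θ => ∫⁻ t, ‖f θ t - f θ₀ t‖ₑ ^ 2 ∂Λ) (𝓝 θ₀) (𝓝 0))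
    {U : ℕ → Ω → E} (hUm : ∀ n, Measurable (U n)) (hU : TendstoInMeasure P U atTop fun _ => θ₀)
    {S : ℕ → Finset ℕ} (hS : ∀ n, (S n).card ≤ n)
    (hUX : ∀ n, IndepFun (U n) (fun ω (j : S n) => X j ω) P) :
    TendstoInMeasure P (fun (n : ℕ) ω => (√(n : ℝ))⁻¹ • ∑ j ∈ S n,
      compensatedIntegral Λ (fun t => f (U n ω) t - f θ₀ t) (X j ω)) atTop 0 := by
  have hg : Measurable (Function.uncurry fun θ t => f θ t - f θ₀ t) :=
    hf.sub ((hf.comp measurable_prodMk_left).comp measurable_snd)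
  have hgB (θ : E) (t : α) : ‖f θ t - f θ₀ t‖ ≤ B + B := norm_sub_le_of_le (hB θ t) (hB θ₀ t)
  have hm (n : ℕ) : Measurable fun ω => ∑ j ∈ S n,
      compensatedIntegral Λ (fun t => f (U n ω) t - f θ₀ t) (X j ω) :=
    Finset.measurable_fun_sum (S n) fun j _ =>
      (measurable_compensatedIntegral_uncurry Λ hg).comp ((hUm n).prodMk (hX j).measurable)
  refine tendstoInMeasure_zero_of_lintegral_enorm_sq
    (fun n => ((hm n).fun_const_smul _).aestronglyMeasurable) ?_
  have hh : Measurable fun θ => ∫⁻ t, ‖f θ t - f θ₀ t‖ₑ ^ 2 ∂Λ :=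
    (hg.enorm.pow_const 2).lintegral_prod_right'
  have hlim := ENNReal.Tendsto.const_mul (a := 2)
    (tendsto_lintegral_comp_of_tendstoInMeasure_const (P := P) hUm hU hh
      (C := ENNReal.ofReal (B + B) ^ 2 * Λ univ) (by finiteness) (fun θ => ?_) hcont)
    (Or.inr ENNReal.ofNat_ne_top)
  · rw [mul_zero] at hlim
    refine tendsto_of_tendsto_of_tendsto_of_le_of_le tendsto_const_nhds hlim
      (fun _ => zero_le) fun n => ?_
    refine (lintegral_enorm_sq_inv_sqrt_smul_le
      (lintegral_enorm_sq_sum_compensatedIntegral_le_of_indepFun hX hindep hg hgB (hUm n) (hUX n))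
      n).trans (mul_le_of_le_one_left' ?_)
    exact ENNReal.ofReal_le_one.2
      (div_le_one_of_le₀ (by exact_mod_cast hS n) (Nat.cast_nonneg n))
  · exact lintegral_enorm_sq_le_of_bound Λ (hgB θ)

theorem tendstoInDistribution_oneStep (hX : ∀ j, IsPoissonRandomMeasure P Λ (X j))
    (hindep : iIndepFun X P) [DecidableEq κ] {f : EuclideanSpace ℝ κ → α → EuclideanSpace ℝ κ}
    (hf : Measurable (Function.uncurry f)) {B : ℝ} (hB : ∀ θ t, ‖f θ t‖ ≤ B)
    {θ₀ : EuclideanSpace ℝ κ}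
    (hcont : Tendsto (fun θ => ∫⁻ t, ‖f θ t - f θ₀ t‖ₑ ^ 2 ∂Λ) (𝓝 θ₀) (𝓝 0))
    {b : EuclideanSpace ℝ κ → EuclideanSpace ℝ κ}
    (hb : (fun θ => b θ - (θ₀ - θ)) =O[𝓝 θ₀] fun θ => ‖θ - θ₀‖ ^ 2)
    {S : Matrix κ κ ℝ} (hS : S.PosSemidef)
    (hcov : ∀ u : EuclideanSpace ℝ κ, u.ofLp ⬝ᵥ S.mulVec u.ofLp =
      ∫ t, inner ℝ u (f θ₀ t) ^ 2 ∂Λ)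
    {N : ℕ → ℕ} (hN : Tendsto N atTop atTop)
    (hdiv : Tendsto (fun n => (N n : ℝ) / n) atTop (𝓝 0))
    (hsqrt : Tendsto (fun n : ℕ => √(n : ℝ) / N n) atTop (𝓝 0))
    {U : ℕ → Ω → EuclideanSpace ℝ κ} (hUm : ∀ n, Measurable (U n))
    (hUX : ∀ n, IndepFun (U n) (fun ω (j : Finset.Ico (N n) n) => X j ω) P)
    (hU : BoundedInProbability P fun n ω => √(N n : ℝ) • (U n ω - θ₀))
    {ϑ : ℕ → Ω → EuclideanSpace ℝ κ} (hϑm : ∀ n, AEMeasurable (ϑ n) P)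
    {V : Set (EuclideanSpace ℝ κ)} (hV : V ∈ 𝓝 θ₀)
    (hϑ : ∀ n, ∀ᵐ ω ∂P, U n ω ∈ V → ϑ n ω = U n ω + (n : ℝ)⁻¹ •
      ∑ j ∈ Finset.Ico (N n) n, (compensatedIntegral Λ (f (U n ω)) (X j ω) + b (U n ω))) :
    TendstoInDistribution (fun (n : ℕ) ω => √(n : ℝ) • (ϑ n ω - θ₀)) atTop id (fun _ => P)
      (multivariateGaussian 0 S) := by
  have hcons := tendstoInMeasure_of_boundedInProbability_sqrt_smul hN hU
  have hbias := tendstoInMeasure_sqrt_smul_sub_add_smul hN hdiv hsqrt hU hb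
  have hplugin := tendstoInMeasure_inv_sqrt_smul_sum_compensatedIntegral_sub hX hindep hf hB hcont
    hUm hcons (S := fun n => Finset.Ico (N n) n) (by simp) hUX
  have hfm (θ : EuclideanSpace ℝ κ) : Measurable (f θ) := hf.comp measurable_prodMk_left
  have hlearn := tendstoInMeasure_inv_sqrt_smul_sum_compensatedIntegral hX hindep (hfm θ₀).neg
    (B := B) (by simpa using hB θ₀) (S := fun n => Finset.range (N n)) (by simpa using hdiv)
  refine tendstoInDistribution_of_tendstoInMeasure_sub _ _
    (tendstoInDistribution_sum_compensatedIntegral hX hindep (hfm θ₀) (hB θ₀) hS hcov) ?_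
    fun n => ((hϑm n).sub_const θ₀).const_smul (√(n : ℝ))
  obtain ⟨r, hr, hrV⟩ := Metric.mem_nhds_iff.1 hV
  refine tendstoInMeasure_zero_of_norm_le (A := fun n => {ω | dist (U n ω) θ₀ < r})
    (tendstoInMeasure_zero_add (tendstoInMeasure_zero_add hbias hplugin) hlearn)
    (by simpa only [compl_ofPred, not_lt] using tendstoInMeasure_iff_dist.1 hcons r hr) ?_
  filter_upwards [eventually_gt_atTop 0, eventually_le_of_tendsto_div hdiv] with n hn hNn
  filter_upwards [hϑ n] with ω hω hUω
  refine le_of_eq (congrArg _ ?_)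
  have hsub (j : ℕ) := compensatedIntegral_sub Λ (hfm (U n ω)) (hfm θ₀) (hB _) (hB _) (X j ω)
  have hneg (j : ℕ) : compensatedIntegral Λ (-f θ₀) (X j ω) =
      -compensatedIntegral Λ (f θ₀) (X j ω) := by
    simp only [compensatedIntegral, Pi.neg_apply, integral_neg, neg_sub_neg, neg_sub]
  simp only [Pi.sub_apply, hω (hrV hUω), hsub, hneg]
  exact sqrt_smul_oneStep_sub_eq hn hNn _ _ _ _

end OneStep

section LearningSize

variable {δ : ℝ}

lemma learningSize_le_rpow (δ : ℝ) (n : ℕ) : (learningSize δ n : ℝ) ≤ (n : ℝ) ^ δ :=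
  Nat.floor_le (by positivity)

lemma tendsto_learningSize (hδ : 0 < δ) : Tendsto (learningSize δ) atTop atTop :=
  tendsto_nat_floor_atTop.comp ((tendsto_rpow_atTop hδ).comp tendsto_natCast_atTop_atTop)

lemma tendsto_learningSize_div (hδ : δ < 1) :
    Tendsto (fun n : ℕ => (learningSize δ n : ℝ) / n) atTop (𝓝 0) := by
  have hlim : Tendsto (fun n : ℕ => (n : ℝ) ^ (-(1 - δ))) atTop (𝓝 0) :=
    (tendsto_rpow_neg_atTop (sub_pos.2 hδ)).comp tendsto_natCast_atTop_atTop
  refine squeeze_zero' (Eventually.of_forall fun _ => by positivity) ?_ hlim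
  filter_upwards [eventually_ge_atTop 1] with n hn
  have hn' : (0 : ℝ) < n := by exact_mod_cast hn
  rw [neg_sub, Real.rpow_sub hn', Real.rpow_one]
  gcongr
  exact learningSize_le_rpow δ n

lemma tendsto_sqrt_div_learningSize (hδ : 1 / 2 < δ) :
    Tendsto (fun n : ℕ => √(n : ℝ) / learningSize δ n) atTop (𝓝 0) := by
  have hlim : Tendsto (fun n : ℕ => 2 * (n : ℝ) ^ (-(δ - 1 / 2))) atTop (𝓝 0) := by
    simpa using ((tendsto_rpow_neg_atTop (sub_pos.2 hδ)).comp
      tendsto_natCast_atTop_atTop).const_mul 2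
  refine squeeze_zero' (Eventually.of_forall fun _ => by positivity) ?_ hlim
  have hbig := ((tendsto_rpow_atTop (by linarith : 0 < δ)).comp
    tendsto_natCast_atTop_atTop).eventually_ge_atTop (2 : ℝ)
  filter_upwards [eventually_ge_atTop 1, hbig] with n hn htwo
  have hn' : (0 : ℝ) < n := by exact_mod_cast hn
  simp only [Function.comp_apply] at htwo
  have hhalf : (n : ℝ) ^ δ / 2 ≤ learningSize δ n := by
    have := Nat.sub_one_lt_floor ((n : ℝ) ^ δ)
    simp only [learningSize]
    linarith
  rw [neg_sub, Real.rpow_sub hn', ← Real.sqrt_eq_rpow]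
  calc √(n : ℝ) / learningSize δ n ≤ √(n : ℝ) / ((n : ℝ) ^ δ / 2) := by gcongr
    _ = 2 * (√(n : ℝ) / (n : ℝ) ^ δ) := by field_simp

end LearningSize

section EvalFirst

variable {Ω : Type*} [MeasurableSpace Ω] {P : Measure Ω} {X : ℕ → Ω → Measure ℝ} {d : ℕ}
  {est : (n : ℕ) → (Fin n → Measure ℝ) → EuclideanSpace ℝ (Fin d)}

lemma measurable_evalFirst (hX : ∀ j, Measurable (X j)) (hest : ∀ n, Measurable (est n)) (n : ℕ) :
    Measurable fun ω => evalFirst est n fun j => X j ω :=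
  (hest n).comp (measurable_pi_lambda _ fun j => hX j)

lemma indepFun_evalFirst (hX : ∀ j, Measurable (X j)) (hindep : iIndepFun X P)
    (hest : ∀ n, Measurable (est n)) (N n : ℕ) :
    IndepFun (fun ω => evalFirst est N fun j => X j ω)
      (fun ω (j : Finset.Ico N n) => X j ω) P := by
  have hdisj : Disjoint (Finset.range N) (Finset.Ico N n) := by
    rw [Finset.disjoint_left]
    intro j hj hj'
    simp only [Finset.mem_range, Finset.mem_Ico] at hj hj'
    omega
  have h := hindep.indepFun_finset _ _ hdisj hX
  exact h.comp (φ := fun x : Finset.range N → Measure ℝ =>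
      est N fun j : Fin N => x ⟨j, Finset.mem_range.2 j.2⟩) (ψ := id)
    ((hest N).comp (measurable_pi_lambda _ fun j => measurable_pi_apply _)) measurable_id

end EvalFirst

section ParametricFamilies

variable {E F α : Type*} [MeasurableSpace α]

lemma eventually_segment_subset [NormedAddCommGroup E] [NormedSpace ℝ E] {s : Set E} {x : E}
    (hs : s ∈ 𝓝 x) : ∀ᶠ y in 𝓝 x, segment ℝ y x ⊆ s := by
  obtain ⟨r, hr, hball⟩ := Metric.mem_nhds_iff.1 hs
  filter_upwards [Metric.ball_mem_nhds x hr] with y hy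
  exact ((convex_ball x r).segment_subset hy (Metric.mem_ball_self hr)).trans hball

lemma measurable_fderiv_apply_of_eventually_measurable [NormedAddCommGroup E] [NormedSpace ℝ E]
    {f : E → α → ℝ} {x : E} (hf : ∀ᶠ y in 𝓝 x, Measurable (f y))
    (hd : ∀ t, DifferentiableAt ℝ (fun y => f y t) x) (v : E) :
    Measurable fun t => fderiv ℝ (fun y => f y t) x v := by
  have hstep : Tendsto (fun k : ℕ => 1 / ((k : ℝ) + 1)) atTop (𝓝[≠] 0) :=
    tendsto_nhdsWithin_iff.2 ⟨tendsto_one_div_add_atTop_nhds_zero_nat,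
      Eventually.of_forall fun _ => Nat.one_div_pos_of_nat.ne'⟩
  have hpt : Tendsto (fun k : ℕ => x + (1 / ((k : ℝ) + 1)) • v) atTop (𝓝 x) := by
    simpa using ((hstep.mono_right nhdsWithin_le_nhds).smul_const v).const_add x
  obtain ⟨k₀, hk₀⟩ := eventually_atTop.1 (hpt.eventually hf)
  refine measurable_of_tendsto_metrizable (fun k => ?_) (tendsto_pi_nhds.2 fun t =>
    ((hd t).hasFDerivAt.hasLineDerivAt v).tendsto_slope_zero.comp
      (hstep.comp (tendsto_add_atTop_nat k₀)))
  exact ((hk₀ (k + k₀) (Nat.le_add_left _ _)).sub hf.self_of_nhds).const_smul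
    (1 / (((k + k₀ : ℕ) : ℝ) + 1))⁻¹

lemma measurable_gradient_of_eventually_measurable {ι : Type*} [Fintype ι]
    {f : EuclideanSpace ℝ ι → α → ℝ} {x : EuclideanSpace ℝ ι}
    (hf : ∀ᶠ y in 𝓝 x, Measurable (f y)) (hd : ∀ t, DifferentiableAt ℝ (fun y => f y t) x) :
    Measurable fun t => gradient (fun y => f y t) x := by
  classical
  refine (MeasurableEquiv.toLp 2 (ι → ℝ)).symm.measurableEmbedding.measurable_comp_iff.1
    (measurable_pi_lambda _ fun i => ?_)
  convert measurable_fderiv_apply_of_eventually_measurable hf hd (EuclideanSpace.single i 1) using 2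
  rw [← inner_gradient_left, EuclideanSpace.inner_single_right]
  simp

lemma measurable_uncurry_indicator_of_continuousOn [TopologicalSpace E]
    [TopologicalSpace.MetrizableSpace E] [SecondCountableTopology E] [MeasurableSpace E]
    [OpensMeasurableSpace E] [TopologicalSpace F] [TopologicalSpace.PseudoMetrizableSpace F]
    [MeasurableSpace F] [BorelSpace F] [Zero F] {Θ : Set E} (hΘ : MeasurableSet Θ) {T : Set α}
    {g : E → α → F} (hc : ∀ t ∈ T, ContinuousOn (fun θ => g θ t) Θ)
    (hm : ∀ θ ∈ Θ, Measurable (T.indicator (g θ))) :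
    Measurable (Function.uncurry (Θ.indicator fun θ => T.indicator (g θ))) := by
  have hsub : Measurable (Function.uncurry fun (θ : Θ) t => T.indicator (g θ) t) := by
    refine measurable_uncurry_of_continuous_of_measurable (fun t => ?_) fun θ => hm θ θ.2
    by_cases ht : t ∈ T
    · simp only [indicator_of_mem ht]
      exact continuousOn_iff_continuous_domRestrict.1 (hc t ht)
    · simpa only [indicator_of_notMem ht] using continuous_const
  refine measurable_of_restrict_of_restrict_compl (hΘ.prod MeasurableSet.univ) ?_ ?_
  · have hincl : Measurable fun p : Θ ×ˢ (univ : Set α) => ((⟨p.1.1, p.2.1⟩ : Θ), p.1.2) := by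
      fun_prop
    convert hsub.comp hincl using 1
    ext ⟨⟨θ, t⟩, hθ, -⟩
    simp only [domRestrict_apply, Function.uncurry, Function.comp_apply, indicator_of_mem hθ]
  · convert measurable_const (a := (0 : F)) using 1
    ext ⟨⟨θ, t⟩, hθ⟩
    have hθ' : θ ∉ Θ := fun h => hθ ⟨h, trivial⟩
    simp only [domRestrict_apply, Function.uncurry, indicator_of_notMem hθ', Pi.zero_apply]

lemma measurable_ringInverse {R : Type*} [NormedRing R] [HasSummableGeomSeries R]
    [MeasurableSpace R] [BorelSpace R] : Measurable (Ring.inverse : R → R) := by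
  classical
  have hpiece : (Ring.inverse : R → R) = {x | IsUnit x}.piecewise Ring.inverse fun _ => 0 := by
    ext x
    by_cases hx : IsUnit x <;> simp [piecewise, hx]
  rw [hpiece]
  refine ContinuousOn.measurable_piecewise ?_ continuousOn_const Units.isOpen.measurableSet
  rintro _ ⟨u, rfl⟩
  exact (NormedRing.inverse_continuousAt u).continuousWithinAt

end ParametricFamilies

section RegularIntensity

variable {d : ℕ}

/-- The gradient in `ϑ` of the log-intensity, that is `λ̇(ϑ, t) / λ(ϑ, t)` where `λ > 0`. -/
noncomputable def logGrad (lam : EuclideanSpace ℝ (Fin d) → ℝ → ℝ)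
    (θ : EuclideanSpace ℝ (Fin d)) (t : ℝ) : EuclideanSpace ℝ (Fin d) :=
  gradient (fun η => Real.log (lam η t)) θ

/-- A family of positive integrable intensities on `T`, indexed by an open set `Θ`, whose logarithm
is twice continuously differentiable in the parameter, with first and second derivatives bounded
by `C`. -/
structure RegularIntensity (T : Set ℝ) (Θ : Set (EuclideanSpace ℝ (Fin d)))
    (lam : EuclideanSpace ℝ (Fin d) → ℝ → ℝ) (C : ℝ≥0) : Prop where
  measurableSet : MeasurableSet T
  isOpen : IsOpen Θ
  measurable : ∀ θ ∈ Θ, Measurable (lam θ)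
  integrableOn : ∀ θ ∈ Θ, IntegrableOn (lam θ) T
  pos : ∀ θ ∈ Θ, ∀ t ∈ T, 0 < lam θ t
  contDiffOn : ∀ t ∈ T, ContDiffOn ℝ 2 (fun θ => Real.log (lam θ t)) Θ
  norm_iteratedFDeriv_le : ∀ k ∈ Finset.Icc 1 2, ∀ θ ∈ Θ, ∀ t ∈ T,
    ‖iteratedFDeriv ℝ k (fun η => Real.log (lam η t)) θ‖ ≤ C

namespace RegularIntensity

variable {T : Set ℝ} {Θ : Set (EuclideanSpace ℝ (Fin d))}
  {lam : EuclideanSpace ℝ (Fin d) → ℝ → ℝ} {C : ℝ≥0} {θ η : EuclideanSpace ℝ (Fin d)} {t : ℝ}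

lemma differentiableAt_log (h : RegularIntensity T Θ lam C) (hθ : θ ∈ Θ) (ht : t ∈ T) :
    DifferentiableAt ℝ (fun η => Real.log (lam η t)) θ :=
  ((h.contDiffOn t ht).contDiffAt (h.isOpen.mem_nhds hθ)).differentiableAt (by norm_num)

lemma hasGradientAt (h : RegularIntensity T Θ lam C) (hθ : θ ∈ Θ) (ht : t ∈ T) :
    HasGradientAt (fun η => lam η t) (lam θ t • logGrad lam θ t) θ := by
  have hexp := (h.differentiableAt_log hθ ht).hasFDerivAt.exp
  rw [Real.exp_log (h.pos θ hθ t ht)] at hexp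
  rw [hasGradientAt_iff_hasFDerivAt, map_smulₛₗ, logGrad, toDual_gradient]
  refine hexp.congr_of_eventuallyEq ?_
  filter_upwards [h.isOpen.mem_nhds hθ] with η hη
  rw [Real.exp_log (h.pos η hη t ht)]

lemma intensityGrad_eq (h : RegularIntensity T Θ lam C) (hθ : θ ∈ Θ) (ht : t ∈ T) :
    intensityGrad lam θ t = lam θ t • logGrad lam θ t :=
  (h.hasGradientAt hθ ht).gradient

lemma inv_smul_intensityGrad (h : RegularIntensity T Θ lam C) (hθ : θ ∈ Θ) (ht : t ∈ T) :
    (lam θ t)⁻¹ • intensityGrad lam θ t = logGrad lam θ t := by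
  rw [h.intensityGrad_eq hθ ht, inv_smul_smul₀ (h.pos θ hθ t ht).ne']

lemma norm_fderiv_log_le (h : RegularIntensity T Θ lam C) (hθ : θ ∈ Θ) (ht : t ∈ T) :
    ‖fderiv ℝ (fun η => Real.log (lam η t)) θ‖ ≤ C := by
  rw [← norm_iteratedFDeriv_one]
  exact h.norm_iteratedFDeriv_le 1 (by simp) θ hθ t ht

lemma norm_logGrad_le (h : RegularIntensity T Θ lam C) (hθ : θ ∈ Θ) (ht : t ∈ T) :
    ‖logGrad lam θ t‖ ≤ C := by
  rw [← (InnerProductSpace.toDual ℝ _).norm_map, logGrad, toDual_gradient]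
  exact h.norm_fderiv_log_le hθ ht

lemma continuousOn_logGrad (h : RegularIntensity T Θ lam C) (ht : t ∈ T) :
    ContinuousOn (fun θ => logGrad lam θ t) Θ :=
  (InnerProductSpace.toDual ℝ _).symm.continuous.comp_continuousOn
    ((h.contDiffOn t ht).continuousOn_fderiv_of_isOpen h.isOpen (by norm_num))

lemma continuousOn_intensity (h : RegularIntensity T Θ lam C) (ht : t ∈ T) :
    ContinuousOn (fun θ => lam θ t) Θ := fun _ hθ =>
  (h.hasGradientAt hθ ht).differentiableAt.continuousAt.continuousWithinAt

lemma measurable_indicator_logGrad (h : RegularIntensity T Θ lam C) (hθ : θ ∈ Θ) :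
    Measurable (T.indicator (logGrad lam θ)) := by
  have hgrad : T.indicator (logGrad lam θ) =
      fun t => gradient (fun η => T.indicator (fun t => Real.log (lam η t)) t) θ := by
    ext1 t
    by_cases ht : t ∈ T
    · simp only [indicator_of_mem ht, logGrad]
    · simp only [indicator_of_notMem ht, gradient_fun_const]
  rw [hgrad]
  refine measurable_gradient_of_eventually_measurable ?_ fun t => ?_
  · filter_upwards [h.isOpen.mem_nhds hθ] with η hη
    exact (h.measurable η hη).log.indicator h.measurableSet
  · by_cases ht : t ∈ T
    · simpa only [indicator_of_mem ht] using h.differentiableAt_log hθ ht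
    · simp only [indicator_of_notMem ht, differentiableAt_const]

/- Intensities at distant parameters may be incomparable, so the estimates below are made along
segments of `Θ` on which the log-intensity varies by at most `1`. -/
lemma eventually_segment_subset (h : RegularIntensity T Θ lam C) (hη : η ∈ Θ) :
    ∀ᶠ θ in 𝓝 η, segment ℝ θ η ⊆ Θ ∧ C * ‖η - θ‖ ≤ 1 := by
  refine (PoissonOneStep.eventually_segment_subset (h.isOpen.mem_nhds hη)).and ?_
  have hcont : Tendsto (fun θ => C * ‖η - θ‖) (𝓝 η) (𝓝 0) :=
    (by fun_prop : Continuous fun θ => C * ‖η - θ‖).tendsto' η 0 (by simp)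
  exact hcont.eventually_le_const one_pos

variable (hseg : segment ℝ θ η ⊆ Θ)
include hseg

lemma abs_log_sub_le (h : RegularIntensity T Θ lam C) (ht : t ∈ T) :
    |Real.log (lam η t) - Real.log (lam θ t)| ≤ C * ‖η - θ‖ :=
  (convex_segment θ η).norm_image_sub_le_of_norm_fderiv_le (𝕜 := ℝ)
    (f := fun η => Real.log (lam η t)) (fun _ hx => h.differentiableAt_log (hseg hx) ht)
    (fun _ hx => h.norm_fderiv_log_le (hseg hx) ht) (left_mem_segment ℝ θ η)
    (right_mem_segment ℝ θ η)

lemma norm_fderiv_log_sub_le (h : RegularIntensity T Θ lam C) (ht : t ∈ T) :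
    ‖fderiv ℝ (fun η => Real.log (lam η t)) η - fderiv ℝ (fun η => Real.log (lam η t)) θ‖ ≤
      C * ‖η - θ‖ := by
  have hc : ContDiffOn ℝ 1 (fderiv ℝ fun η => Real.log (lam η t)) Θ :=
    (h.contDiffOn t ht).fderiv_of_isOpen h.isOpen (by norm_num)
  refine (convex_segment θ η).norm_image_sub_le_of_norm_fderiv_le (𝕜 := ℝ)
    (fun x hx => (hc.contDiffAt (h.isOpen.mem_nhds (hseg hx))).differentiableAt (by norm_num))
    (fun x hx => ?_) (left_mem_segment ℝ θ η) (right_mem_segment ℝ θ η)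
  rw [← norm_iteratedFDeriv_one, norm_iteratedFDeriv_fderiv]
  exact h.norm_iteratedFDeriv_le 2 (by simp) x (hseg hx) t ht

lemma abs_log_sub_sub_inner_le (h : RegularIntensity T Θ lam C) (ht : t ∈ T) :
    |Real.log (lam η t) - Real.log (lam θ t) - inner ℝ (logGrad lam θ t) (η - θ)| ≤
      C * ‖η - θ‖ ^ 2 := by
  rw [logGrad, inner_gradient_left, sq, ← mul_assoc]
  refine (convex_segment θ η).norm_image_sub_le_of_norm_fderiv_le' (𝕜 := ℝ)
    (f := fun η => Real.log (lam η t)) (fun x hx => h.differentiableAt_log (hseg hx) ht)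
    (fun x hx => ?_) (left_mem_segment ℝ θ η) (right_mem_segment ℝ θ η)
  have hsub : segment ℝ θ x ⊆ segment ℝ θ η :=
    (convex_segment θ η).segment_subset (left_mem_segment ℝ θ η) hx
  refine (h.norm_fderiv_log_sub_le (hsub.trans hseg) ht).trans ?_
  gcongr
  obtain ⟨s, ⟨hs0, hs1⟩, rfl⟩ := segment_eq_image' ℝ θ η ▸ hx
  rw [add_sub_cancel_left, norm_smul, Real.norm_of_nonneg hs0]
  exact mul_le_of_le_one_left (norm_nonneg _) hs1

variable (hsmall : C * ‖η - θ‖ ≤ 1)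
include hsmall

lemma intensity_le (h : RegularIntensity T Θ lam C) (ht : t ∈ T) :
    lam θ t ≤ Real.exp 1 * lam η t := by
  have hθ := h.pos θ (hseg (left_mem_segment ℝ θ η)) t ht
  have hη := h.pos η (hseg (right_mem_segment ℝ θ η)) t ht
  rw [← Real.log_le_log_iff hθ (by positivity), Real.log_mul (Real.exp_ne_zero _) hη.ne',
    Real.log_exp]
  linarith [neg_abs_le (Real.log (lam η t) - Real.log (lam θ t)), h.abs_log_sub_le hseg ht]

lemma abs_intensity_sub_sub_inner_le (h : RegularIntensity T Θ lam C) (ht : t ∈ T) :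
    |lam η t - lam θ t - lam θ t * inner ℝ (logGrad lam θ t) (η - θ)| ≤
      Real.exp 1 * (C ^ 2 + C) * ‖η - θ‖ ^ 2 * lam η t := by
  have hθ := h.pos θ (hseg (left_mem_segment ℝ θ η)) t ht
  have hη := h.pos η (hseg (right_mem_segment ℝ θ η)) t ht
  set a := Real.log (lam η t) - Real.log (lam θ t) with ha
  set b := inner ℝ (logGrad lam θ t) (η - θ)
  have ha_le : |a| ≤ C * ‖η - θ‖ := h.abs_log_sub_le hseg ht
  have hab : |a - b| ≤ C * ‖η - θ‖ ^ 2 := h.abs_log_sub_sub_inner_le hseg ht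
  have hexp : |Real.exp a - 1 - a| ≤ (C * ‖η - θ‖) ^ 2 :=
    (Real.abs_exp_sub_one_sub_id_le (ha_le.trans hsmall)).trans
      (by rw [← sq_abs]; gcongr)
  have hratio : lam η t = lam θ t * Real.exp a := by
    rw [ha, Real.exp_sub, Real.exp_log hθ, Real.exp_log hη, mul_div_cancel₀ _ hθ.ne']
  calc |lam η t - lam θ t - lam θ t * b|
      = lam θ t * |Real.exp a - 1 - a + (a - b)| := by
        rw [hratio, ← abs_of_pos hθ, ← abs_mul, abs_of_pos hθ]
        ring_nf
    _ ≤ (Real.exp 1 * lam η t) * ((C * ‖η - θ‖) ^ 2 + C * ‖η - θ‖ ^ 2) := by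
        gcongr
        · exact h.intensity_le hseg hsmall ht
        · exact (abs_add_le _ _).trans (add_le_add hexp hab)
    _ = Real.exp 1 * (C ^ 2 + C) * ‖η - θ‖ ^ 2 * lam η t := by ring

end RegularIntensity

end RegularIntensity

section TruncatedInverse

variable {R : Type*} [NormedRing R] {M : ℝ} {A : R}

/-- The inverse of a unit `A` whose inverse has norm at most `M`, and `0` elsewhere: a bounded
modification of the inverse near a given unit. -/
noncomputable def truncInverse (M : ℝ) : R → R :=
  {A | ‖Ring.inverse A‖ ≤ M}.indicator Ring.inverse

lemma truncInverse_eq (hA : ‖Ring.inverse A‖ ≤ M) : truncInverse M A = Ring.inverse A :=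
  indicator_of_mem (s := {A : R | ‖Ring.inverse A‖ ≤ M}) hA _

lemma norm_truncInverse_le (hM : 0 ≤ M) (A : R) : ‖truncInverse M A‖ ≤ M := by
  by_cases hA : ‖Ring.inverse A‖ ≤ M
  · rwa [truncInverse_eq hA]
  · rwa [truncInverse, indicator_of_notMem (s := {A : R | ‖Ring.inverse A‖ ≤ M}) hA, norm_zero]

lemma continuousAt_ringInverse [HasSummableGeomSeries R] (hA : IsUnit A) :
    ContinuousAt (Ring.inverse : R → R) A :=
  hA.unit_spec ▸ NormedRing.inverse_continuousAt hA.unit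

lemma eventually_norm_ringInverse_le [HasSummableGeomSeries R] (hA : IsUnit A)
    (hM : ‖Ring.inverse A‖ < M) : ∀ᶠ A' in 𝓝 A, ‖Ring.inverse A'‖ ≤ M :=
  (continuousAt_ringInverse hA).norm.eventually_le_const hM

lemma continuousAt_truncInverse [HasSummableGeomSeries R] (hA : IsUnit A)
    (hM : ‖Ring.inverse A‖ < M) : ContinuousAt (truncInverse M) A :=
  (continuousAt_ringInverse hA).congr <|
    (eventually_norm_ringInverse_le hA hM).mono fun _ h => (truncInverse_eq h).symm

lemma measurable_truncInverse [HasSummableGeomSeries R] [MeasurableSpace R] [BorelSpace R]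
    (M : ℝ) : Measurable (truncInverse M : R → R) :=
  measurable_ringInverse.indicator (measurable_ringInverse.norm measurableSet_Iic)

end TruncatedInverse

section ToEuclideanCLM

variable {𝕜 n : Type*} [RCLike 𝕜] [Fintype n] [DecidableEq n]

lemma toEuclideanCLM_inv (A : Matrix n n 𝕜) :
    Matrix.toEuclideanCLM (𝕜 := 𝕜) A⁻¹ = Ring.inverse (Matrix.toEuclideanCLM (𝕜 := 𝕜) A) := by
  rw [Matrix.nonsing_inv_eq_ringInverse]
  by_cases hA : IsUnit A
  · rw [← one_mul (Ring.inverse (Matrix.toEuclideanCLM (𝕜 := 𝕜) A)),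
      Ring.eq_mul_inverse_iff_mul_eq _ _ _ (hA.map _), ← map_mul, Ring.inverse_mul_cancel _ hA,
      map_one]
  · rw [Ring.inverse_non_unit _ hA, map_zero, Ring.inverse_non_unit]
    rwa [MulEquiv.isUnit_map]

lemma toEuclideanCLM_eq_of_inner {A : Matrix n n ℝ}
    {L : EuclideanSpace ℝ n →L[ℝ] EuclideanSpace ℝ n}
    (h : ∀ i j, inner ℝ (EuclideanSpace.single i 1) (L (EuclideanSpace.single j 1)) = A i j) :
    Matrix.toEuclideanCLM (𝕜 := ℝ) A = L := by
  refine ContinuousLinearMap.coe_injective <|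
    (EuclideanSpace.basisFun n ℝ).toBasis.ext fun j => PiLp.ext fun i => ?_
  simpa [EuclideanSpace.inner_single_left] using (h i j).symm

end ToEuclideanCLM

section Fisher

lemma continuous_rankOne_self {𝕜 E : Type*} [RCLike 𝕜] [NormedAddCommGroup E]
    [InnerProductSpace 𝕜 E] : Continuous fun v : E => InnerProductSpace.rankOne 𝕜 v v :=
  ((ContinuousLinearMap.smulRightL 𝕜 E E).continuous.comp (innerSL 𝕜).continuous).clm_apply
    continuous_id

lemma integral_intensityMeasure {F : Type*} [NormedAddCommGroup F] [NormedSpace ℝ F]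
    {T : Set ℝ} {lam : ℝ → ℝ} (hT : MeasurableSet T) (hm : Measurable lam)
    (hpos : ∀ t ∈ T, 0 ≤ lam t) (f : ℝ → F) :
    ∫ t, f t ∂(intensityMeasure T lam) = ∫ t in T, lam t • f t := by
  rw [intensityMeasure, integral_withDensity_eq_integral_toReal_smul (by fun_prop) (by simp)]
  refine setIntegral_congr_fun hT fun t ht => ?_
  simp only [ENNReal.toReal_ofReal (hpos t ht)]

variable {d : ℕ}

/-- The Fisher information as an operator on the parameter space. It is set to zero outside `Θ`,
where nothing is known about the intensities, so that it depends measurably on the parameter. -/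
noncomputable def fisherOp (T : Set ℝ) (Θ : Set (EuclideanSpace ℝ (Fin d)))
    (lam : EuclideanSpace ℝ (Fin d) → ℝ → ℝ) :
    EuclideanSpace ℝ (Fin d) → EuclideanSpace ℝ (Fin d) →L[ℝ] EuclideanSpace ℝ (Fin d) :=
  Θ.indicator fun θ => Matrix.toEuclideanCLM (𝕜 := ℝ) (fisherInfo T lam θ)

namespace RegularIntensity

variable {T : Set ℝ} {Θ : Set (EuclideanSpace ℝ (Fin d))}
  {lam : EuclideanSpace ℝ (Fin d) → ℝ → ℝ} {C : ℝ≥0} {θ η : EuclideanSpace ℝ (Fin d)} {t : ℝ}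

lemma aestronglyMeasurable_logGrad (h : RegularIntensity T Θ lam C) (hθ : θ ∈ Θ) :
    AEStronglyMeasurable (logGrad lam θ) (volume.restrict T) :=
  (h.measurable_indicator_logGrad hθ).aestronglyMeasurable.congr
    (indicator_ae_eq_restrict h.measurableSet)

lemma integrableOn_smul {F : Type*} [NormedAddCommGroup F] [NormedSpace ℝ F]
    (h : RegularIntensity T Θ lam C) (hθ : θ ∈ Θ) {φ : ℝ → F}
    (hφ : AEStronglyMeasurable φ (volume.restrict T)) {B : ℝ} (hB : ∀ t ∈ T, ‖φ t‖ ≤ B) :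
    IntegrableOn (fun t => lam θ t • φ t) T :=
  Integrable.smul_bdd (h.integrableOn θ hθ) B hφ ((ae_restrict_mem h.measurableSet).mono hB)

lemma aestronglyMeasurable_rankOne_logGrad (h : RegularIntensity T Θ lam C) (hθ : θ ∈ Θ) :
    AEStronglyMeasurable (fun t => InnerProductSpace.rankOne ℝ (logGrad lam θ t) (logGrad lam θ t))
      (volume.restrict T) :=
  continuous_rankOne_self.comp_aestronglyMeasurable (h.aestronglyMeasurable_logGrad hθ)

lemma norm_rankOne_logGrad_le (h : RegularIntensity T Θ lam C) (hθ : θ ∈ Θ) (ht : t ∈ T) :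
    ‖InnerProductSpace.rankOne ℝ (logGrad lam θ t) (logGrad lam θ t)‖ ≤ (C : ℝ) ^ 2 := by
  rw [InnerProductSpace.norm_rankOne, ← sq]
  gcongr
  exact h.norm_logGrad_le hθ ht

lemma integrableOn_rankOne_logGrad (h : RegularIntensity T Θ lam C) (hθ : θ ∈ Θ) :
    IntegrableOn (fun t => lam θ t •
      InnerProductSpace.rankOne ℝ (logGrad lam θ t) (logGrad lam θ t)) T :=
  h.integrableOn_smul hθ (h.aestronglyMeasurable_rankOne_logGrad hθ)
    fun _ ht => h.norm_rankOne_logGrad_le hθ ht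

lemma fisherOp_eq_integral (h : RegularIntensity T Θ lam C) (hθ : θ ∈ Θ) :
    fisherOp T Θ lam θ =
      ∫ t in T, lam θ t • InnerProductSpace.rankOne ℝ (logGrad lam θ t) (logGrad lam θ t) := by
  rw [fisherOp, indicator_of_mem hθ]
  refine toEuclideanCLM_eq_of_inner fun i j => ?_
  have hint := h.integrableOn_rankOne_logGrad hθ
  rw [ContinuousLinearMap.integral_apply hint, ← integral_inner (hint.apply_continuousLinearMap _),
    fisherInfo, Matrix.of_apply]
  refine setIntegral_congr_fun h.measurableSet fun t ht => ?_
  have hpos := (h.pos θ hθ t ht).ne'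
  simp only [smul_apply, InnerProductSpace.rankOne_apply, EuclideanSpace.inner_single_left,
    EuclideanSpace.inner_single_right, Real.ringHom_apply, one_mul, PiLp.smul_apply, smul_eq_mul,
    h.intensityGrad_eq hθ ht]
  field_simp

lemma integrableOn_inner_smul_logGrad (h : RegularIntensity T Θ lam C) (hθ : θ ∈ Θ)
    (v : EuclideanSpace ℝ (Fin d)) :
    IntegrableOn (fun t => lam θ t • inner ℝ (logGrad lam θ t) v • logGrad lam θ t) T :=
  (h.integrableOn_rankOne_logGrad hθ).apply_continuousLinearMap v

lemma fisherOp_apply (h : RegularIntensity T Θ lam C) (hθ : θ ∈ Θ)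
    (v : EuclideanSpace ℝ (Fin d)) :
    fisherOp T Θ lam θ v = ∫ t in T, lam θ t • inner ℝ (logGrad lam θ t) v • logGrad lam θ t := by
  rw [h.fisherOp_eq_integral hθ,
    ContinuousLinearMap.integral_apply (h.integrableOn_rankOne_logGrad hθ)]
  rfl

lemma inner_fisherOp_self (h : RegularIntensity T Θ lam C) (hθ : θ ∈ Θ)
    (v : EuclideanSpace ℝ (Fin d)) :
    inner ℝ v (fisherOp T Θ lam θ v) = ∫ t in T, lam θ t • inner ℝ v (logGrad lam θ t) ^ 2 := by
  rw [h.fisherOp_apply hθ, ← integral_inner (h.integrableOn_inner_smul_logGrad hθ v)]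
  refine integral_congr_ae (Eventually.of_forall fun t => ?_)
  simp [inner_smul_right, real_inner_comm v, sq]

lemma continuousAt_fisherOp (h : RegularIntensity T Θ lam C) (hη : η ∈ Θ) :
    ContinuousAt (fisherOp T Θ lam) η := by
  have heq : fisherOp T Θ lam =ᶠ[𝓝 η] fun θ =>
      ∫ t in T, lam θ t • InnerProductSpace.rankOne ℝ (logGrad lam θ t) (logGrad lam θ t) :=
    mem_of_superset (h.isOpen.mem_nhds hη) fun θ hθ => h.fisherOp_eq_integral hθ
  refine ContinuousAt.congr (continuousAt_of_dominated
    (bound := fun t => Real.exp 1 * lam η t * C ^ 2) ?_ ?_ ?_ ?_) heq.symm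
  · filter_upwards [h.isOpen.mem_nhds hη] with θ hθ
    exact (h.integrableOn_rankOne_logGrad hθ).aestronglyMeasurable
  · filter_upwards [h.eventually_segment_subset hη] with θ ⟨hseg, hsmall⟩
    filter_upwards [ae_restrict_mem h.measurableSet] with t ht
    have hθ := hseg (left_mem_segment ℝ θ η)
    rw [norm_smul, Real.norm_of_nonneg (h.pos θ hθ t ht).le]
    exact mul_le_mul (h.intensity_le hseg hsmall ht) (h.norm_rankOne_logGrad_le hθ ht)
      (norm_nonneg _) (by have := h.pos η hη t ht; positivity)
  · exact ((h.integrableOn η hη).const_mul _).mul_const _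
  · filter_upwards [ae_restrict_mem h.measurableSet] with t ht
    have hlam := (h.continuousOn_intensity ht).continuousAt (h.isOpen.mem_nhds hη)
    have hgrad := (h.continuousOn_logGrad ht).continuousAt (h.isOpen.mem_nhds hη)
    exact hlam.smul (continuous_rankOne_self.continuousAt.comp hgrad)

lemma measurable_fisherOp (h : RegularIntensity T Θ lam C) : Measurable (fisherOp T Θ lam) := by
  classical
  rw [← piecewise_same Θ (fisherOp T Θ lam)]
  exact ContinuousOn.measurable_piecewise
    (fun θ hθ => (h.continuousAt_fisherOp hθ).continuousWithinAt)
    (continuousOn_const.congr fun θ hθ => indicator_of_notMem hθ _) h.isOpen.measurableSet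

end RegularIntensity

end Fisher

lemma tendsto_lintegral_enorm_sub_sq {α E F : Type*} [MeasurableSpace α] [TopologicalSpace E]
    [FirstCountableTopology E] [NormedAddCommGroup F] [MeasurableSpace F] [BorelSpace F]
    [SecondCountableTopology F] (μ : Measure α) [IsFiniteMeasure μ] {f : E → α → F} {θ₀ : E}
    (hf : ∀ θ, Measurable (f θ)) {B : ℝ} (hB : ∀ θ t, ‖f θ t‖ ≤ B)
    (hc : ∀ t, ContinuousAt (fun θ => f θ t) θ₀) :
    Tendsto (fun θ => ∫⁻ t, ‖f θ t - f θ₀ t‖ₑ ^ 2 ∂μ) (𝓝 θ₀) (𝓝 0) := by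
  have hB' (θ : E) (t : α) : ‖f θ t‖ₑ ≤ ENNReal.ofReal B := by
    rw [← ofReal_norm]
    exact ENNReal.ofReal_le_ofReal (hB θ t)
  have hlim : Tendsto (fun θ => ∫⁻ t, ‖f θ t - f θ₀ t‖ₑ ^ 2 ∂μ) (𝓝 θ₀) (𝓝 (∫⁻ _, 0 ∂μ)) := by
    refine tendsto_lintegral_filter_of_dominated_convergence
      (fun _ => (ENNReal.ofReal B + ENNReal.ofReal B) ^ 2)
      (Eventually.of_forall fun θ => (((hf θ).sub (hf θ₀)).enorm.pow_const 2))
      (Eventually.of_forall fun θ => ae_of_all _ fun t => ?_) ?_ (ae_of_all _ fun t => ?_)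
    · gcongr
      exact (enorm_sub_le).trans (add_le_add (hB' θ t) (hB' θ₀ t))
    · rw [lintegral_const]
      finiteness
    · have h := (ENNReal.continuous_pow 2).continuousAt.comp
        ((hc t).sub (continuousAt_const (y := f θ₀ t))).enorm
      simpa [Function.comp_def] using h.tendsto
  simpa using hlim

section Score

variable {d : ℕ}

/-- The score function `λ̇(ϑ, t) / λ(ϑ, t)`, extended by zero outside `Θ × T`. -/
noncomputable def scoreFunction (T : Set ℝ) (Θ : Set (EuclideanSpace ℝ (Fin d)))
    (lam : EuclideanSpace ℝ (Fin d) → ℝ → ℝ) :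
    EuclideanSpace ℝ (Fin d) → ℝ → EuclideanSpace ℝ (Fin d) :=
  Θ.indicator fun θ => T.indicator (logGrad lam θ)

/-- The mean of the score at `ϑ` of an observation with intensity `lam η`, extended by zero
outside `Θ`. -/
noncomputable def scoreMean (T : Set ℝ) (Θ : Set (EuclideanSpace ℝ (Fin d)))
    (lam : EuclideanSpace ℝ (Fin d) → ℝ → ℝ) (η : EuclideanSpace ℝ (Fin d)) :
    EuclideanSpace ℝ (Fin d) → EuclideanSpace ℝ (Fin d) :=
  Θ.indicator fun θ => ∫ t in T, (lam η t - lam θ t) • logGrad lam θ t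

namespace RegularIntensity

variable {T : Set ℝ} {Θ : Set (EuclideanSpace ℝ (Fin d))}
  {lam : EuclideanSpace ℝ (Fin d) → ℝ → ℝ} {C : ℝ≥0} {θ η : EuclideanSpace ℝ (Fin d)}

lemma measurable_uncurry_scoreFunction (h : RegularIntensity T Θ lam C) :
    Measurable (Function.uncurry (scoreFunction T Θ lam)) :=
  measurable_uncurry_indicator_of_continuousOn h.isOpen.measurableSet
    (fun _ ht => h.continuousOn_logGrad ht) fun _ hθ => h.measurable_indicator_logGrad hθ

lemma measurable_scoreFunction (h : RegularIntensity T Θ lam C) (θ : EuclideanSpace ℝ (Fin d)) :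
    Measurable (scoreFunction T Θ lam θ) :=
  h.measurable_uncurry_scoreFunction.of_uncurry_left

lemma norm_scoreFunction_le (h : RegularIntensity T Θ lam C) (θ : EuclideanSpace ℝ (Fin d))
    (t : ℝ) : ‖scoreFunction T Θ lam θ t‖ ≤ C := by
  by_cases hθ : θ ∈ Θ
  · rw [scoreFunction, indicator_of_mem hθ]
    by_cases ht : t ∈ T
    · rw [indicator_of_mem ht]
      exact h.norm_logGrad_le hθ ht
    · rw [indicator_of_notMem ht, norm_zero]
      exact C.2
  · rw [scoreFunction, indicator_of_notMem hθ, Pi.zero_apply, norm_zero]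
    exact C.2

lemma continuousAt_scoreFunction (h : RegularIntensity T Θ lam C) (hη : η ∈ Θ) (t : ℝ) :
    ContinuousAt (fun θ => scoreFunction T Θ lam θ t) η := by
  have hΘ := h.isOpen.mem_nhds hη
  have heq : (fun θ => T.indicator (logGrad lam θ) t) =ᶠ[𝓝 η] fun θ => scoreFunction T Θ lam θ t :=
    mem_of_superset hΘ fun θ hθ => by simp only [mem_ofPred_eq, scoreFunction, indicator_of_mem hθ]
  refine ContinuousAt.congr ?_ heq
  by_cases ht : t ∈ T
  · simpa only [indicator_of_mem ht] using (h.continuousOn_logGrad ht).continuousAt hΘ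
  · simpa only [indicator_of_notMem ht] using continuousAt_const

lemma integrableOn_smul_logGrad (h : RegularIntensity T Θ lam C) (hη : η ∈ Θ) (hθ : θ ∈ Θ) :
    IntegrableOn (fun t => lam η t • logGrad lam θ t) T :=
  h.integrableOn_smul hη (h.aestronglyMeasurable_logGrad hθ) fun _ ht => h.norm_logGrad_le hθ ht

lemma measurable_scoreMean (h : RegularIntensity T Θ lam C) (hη : η ∈ Θ) :
    Measurable (scoreMean T Θ lam η) := by
  have hmeas := measurable_uncurry_indicator_of_continuousOn h.isOpen.measurableSet
    (T := T) (g := fun θ t => (lam η t - lam θ t) • logGrad lam θ t)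
    (fun t ht => (continuousOn_const.sub (h.continuousOn_intensity ht)).smul
      (h.continuousOn_logGrad ht)) fun θ hθ => ?_
  · convert measurable_integral_of_measurable_uncurry (volume.restrict T) hmeas using 2 with θ
    by_cases hθ : θ ∈ Θ
    · simp only [scoreMean, indicator_of_mem hθ]
      exact setIntegral_congr_fun h.measurableSet fun t ht => by simp only [indicator_of_mem ht]
    · simp [scoreMean, hθ]
  · rw [indicator_smul]
    exact ((h.measurable η hη).sub (h.measurable θ hθ)).smul (h.measurable_indicator_logGrad hθ)

lemma score_eq (h : RegularIntensity T Θ lam C) (hη : η ∈ Θ) (hθ : θ ∈ Θ) {x : Measure ℝ}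
    (hx : finitePart x = x) :
    score T lam θ x = compensatedIntegral (intensityMeasure T (lam η)) (scoreFunction T Θ lam θ) x +
      scoreMean T Θ lam η θ := by
  have hind : scoreFunction T Θ lam θ = T.indicator (logGrad lam θ) := indicator_of_mem hθ _
  have hgrad (μ : Measure ℝ) (c : ℝ → ℝ) :
      ∫ t in T, c t • ((lam θ t)⁻¹ • intensityGrad lam θ t) ∂μ =
        ∫ t in T, c t • logGrad lam θ t ∂μ :=
    setIntegral_congr_fun h.measurableSet fun t ht => by
      simp only [h.inv_smul_intensityGrad hθ ht]
  have hΛ : ∫ t, T.indicator (logGrad lam θ) t ∂(intensityMeasure T (lam η)) =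
      ∫ t in T, lam η t • logGrad lam θ t := by
    rw [integral_intensityMeasure h.measurableSet (h.measurable η hη)
      fun t ht => (h.pos η hη t ht).le]
    exact setIntegral_congr_fun h.measurableSet fun t ht => by simp only [indicator_of_mem ht]
  have hx' := hgrad x 1
  simp only [Pi.one_apply, one_smul] at hx'
  rw [score, hx', hgrad, compensatedIntegral, hx, hind, hΛ, integral_indicator h.measurableSet,
    scoreMean, indicator_of_mem hθ]
  simp only [sub_smul]
  rw [integral_sub (h.integrableOn_smul_logGrad hη hθ) (h.integrableOn_smul_logGrad hθ hθ),
    sub_add_sub_cancel]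

lemma norm_scoreMean_sub_le (h : RegularIntensity T Θ lam C) (hseg : segment ℝ θ η ⊆ Θ)
    (hsmall : C * ‖η - θ‖ ≤ 1) :
    ‖scoreMean T Θ lam η θ - fisherOp T Θ lam θ (η - θ)‖ ≤
      Real.exp 1 * (C ^ 2 + C) * C * (∫ t in T, lam η t) * ‖η - θ‖ ^ 2 := by
  have hθ : θ ∈ Θ := hseg (left_mem_segment ℝ θ η)
  have hη : η ∈ Θ := hseg (right_mem_segment ℝ θ η)
  have hint : IntegrableOn (fun t => (lam η t - lam θ t) • logGrad lam θ t) T := by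
    simp only [sub_smul]
    exact (h.integrableOn_smul_logGrad hη hθ).sub (h.integrableOn_smul_logGrad hθ hθ)
  rw [scoreMean, indicator_of_mem hθ, h.fisherOp_apply hθ,
    ← integral_sub hint (h.integrableOn_inner_smul_logGrad hθ _)]
  calc ‖∫ t in T, ((lam η t - lam θ t) • logGrad lam θ t -
        lam θ t • inner ℝ (logGrad lam θ t) (η - θ) • logGrad lam θ t)‖
      ≤ ∫ t in T, Real.exp 1 * (C ^ 2 + C) * ‖η - θ‖ ^ 2 * lam η t * C := by
        refine norm_integral_le_of_norm_le
          (((h.integrableOn η hη).const_mul _).mul_const _) ?_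
        filter_upwards [ae_restrict_mem h.measurableSet] with t ht
        rw [smul_smul, ← sub_smul, norm_smul]
        have := h.pos η hη t ht
        gcongr
        · exact h.abs_intensity_sub_sub_inner_le hseg hsmall ht
        · exact h.norm_logGrad_le hθ ht
    _ = Real.exp 1 * (C ^ 2 + C) * C * (∫ t in T, lam η t) * ‖η - θ‖ ^ 2 := by
        rw [integral_mul_const, integral_const_mul]
        ring

end RegularIntensity

end Score

section Influence

variable {d : ℕ}

/-- The influence function of the one-step correction started at `ϑ`, that is the inverse Fisher
information applied to the score function. The truncation of the inverse keeps it bounded. -/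
noncomputable def influence (T : Set ℝ) (Θ : Set (EuclideanSpace ℝ (Fin d)))
    (lam : EuclideanSpace ℝ (Fin d) → ℝ → ℝ) (M : ℝ) (θ : EuclideanSpace ℝ (Fin d)) (t : ℝ) :
    EuclideanSpace ℝ (Fin d) :=
  truncInverse M (fisherOp T Θ lam θ) (scoreFunction T Θ lam θ t)

lemma toEuclideanLin_inv_fisherInfo {T : Set ℝ} {Θ : Set (EuclideanSpace ℝ (Fin d))}
    {lam : EuclideanSpace ℝ (Fin d) → ℝ → ℝ} {θ : EuclideanSpace ℝ (Fin d)} (hθ : θ ∈ Θ)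
    (v : EuclideanSpace ℝ (Fin d)) :
    Matrix.toEuclideanLin (fisherInfo T lam θ)⁻¹ v = Ring.inverse (fisherOp T Θ lam θ) v := by
  rw [fisherOp, indicator_of_mem hθ, ← toEuclideanCLM_inv]
  rfl

lemma isUnit_fisherOp {T : Set ℝ} {Θ : Set (EuclideanSpace ℝ (Fin d))}
    {lam : EuclideanSpace ℝ (Fin d) → ℝ → ℝ} {θ : EuclideanSpace ℝ (Fin d)} (hθ : θ ∈ Θ)
    (hI : (fisherInfo T lam θ).PosDef) : IsUnit (fisherOp T Θ lam θ) := by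
  rw [fisherOp, indicator_of_mem hθ]
  exact hI.isUnit.map _

namespace RegularIntensity

variable {T : Set ℝ} {Θ : Set (EuclideanSpace ℝ (Fin d))}
  {lam : EuclideanSpace ℝ (Fin d) → ℝ → ℝ} {C : ℝ≥0} {θ η : EuclideanSpace ℝ (Fin d)} {M : ℝ}

lemma measurable_uncurry_influence (h : RegularIntensity T Θ lam C) (M : ℝ) :
    Measurable (Function.uncurry (influence T Θ lam M)) :=
  ContinuousLinearMap.measurable_apply₂.comp
    ((((measurable_truncInverse M).comp h.measurable_fisherOp).comp measurable_fst).prodMk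
      h.measurable_uncurry_scoreFunction)

lemma norm_influence_le (h : RegularIntensity T Θ lam C) (hM : 0 ≤ M)
    (θ : EuclideanSpace ℝ (Fin d)) (t : ℝ) : ‖influence T Θ lam M θ t‖ ≤ M * C :=
  (ContinuousLinearMap.le_opNorm _ _).trans
    (mul_le_mul (norm_truncInverse_le hM _) (h.norm_scoreFunction_le θ t) (norm_nonneg _) hM)

variable (hη : η ∈ Θ) (hI : (fisherInfo T lam η).PosDef)
  (hM : ‖Ring.inverse (fisherOp T Θ lam η)‖ < M)
include hη hI hM

lemma continuousAt_influence (h : RegularIntensity T Θ lam C) (t : ℝ) :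
    ContinuousAt (fun θ => influence T Θ lam M θ t) η :=
  ((continuousAt_truncInverse (isUnit_fisherOp hη hI) hM).comp
    (h.continuousAt_fisherOp hη)).clm_apply (h.continuousAt_scoreFunction hη t)

lemma eventually_mem_and_norm_ringInverse_fisherOp_le (h : RegularIntensity T Θ lam C) :
    ∀ᶠ θ in 𝓝 η, θ ∈ Θ ∧ ‖Ring.inverse (fisherOp T Θ lam θ)‖ ≤ M :=
  (h.isOpen.eventually_mem hη).and <| (h.continuousAt_fisherOp hη).eventually
    (eventually_norm_ringInverse_le (isUnit_fisherOp hη hI) hM)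

/- This is the Newton step: to first order the score at `θ` has mean `I(θ) (η - θ)`. -/
lemma isBigO_truncInverse_scoreMean_sub (h : RegularIntensity T Θ lam C) :
    (fun θ => truncInverse M (fisherOp T Θ lam θ) (scoreMean T Θ lam η θ) - (η - θ))
      =O[𝓝 η] fun θ => ‖θ - η‖ ^ 2 := by
  have hunit : ∀ᶠ θ in 𝓝 η, IsUnit (fisherOp T Θ lam θ) :=
    (h.continuousAt_fisherOp hη).eventually (Units.isOpen.eventually_mem (isUnit_fisherOp hη hI))
  refine Asymptotics.IsBigO.of_bound
    (M * (Real.exp 1 * (C ^ 2 + C) * C * ∫ t in T, lam η t)) ?_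
  filter_upwards [hunit, h.eventually_mem_and_norm_ringInverse_fisherOp_le hη hI hM,
    h.eventually_segment_subset hη] with θ hu ⟨_, hle⟩ ⟨hseg, hsmall⟩
  have hcancel : Ring.inverse (fisherOp T Θ lam θ) (fisherOp T Θ lam θ (η - θ)) = η - θ := by
    rw [← mul_apply_eq_comp, Ring.inverse_mul_cancel _ hu,
      one_apply_eq_self]
  rw [truncInverse_eq hle, norm_pow, norm_norm, norm_sub_rev θ η, mul_assoc]
  calc ‖Ring.inverse (fisherOp T Θ lam θ) (scoreMean T Θ lam η θ) - (η - θ)‖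
      = ‖Ring.inverse (fisherOp T Θ lam θ)
          (scoreMean T Θ lam η θ - fisherOp T Θ lam θ (η - θ))‖ := by rw [map_sub, hcancel]
    _ ≤ M * (Real.exp 1 * (C ^ 2 + C) * C * (∫ t in T, lam η t) * ‖η - θ‖ ^ 2) :=
        (ContinuousLinearMap.le_opNorm _ _).trans <| mul_le_mul hle
          (h.norm_scoreMean_sub_le hseg hsmall) (norm_nonneg _) ((norm_nonneg _).trans hM.le)

lemma dotProduct_inv_fisherInfo_mulVec (h : RegularIntensity T Θ lam C)
    (u : EuclideanSpace ℝ (Fin d)) :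
    u.ofLp ⬝ᵥ (fisherInfo T lam η)⁻¹.mulVec u.ofLp =
      ∫ t, inner ℝ u (influence T Θ lam M η t) ^ 2 ∂(intensityMeasure T (lam η)) := by
  set L := Ring.inverse (fisherOp T Θ lam η) with hL
  have hL_eq : Matrix.toEuclideanCLM (𝕜 := ℝ) (fisherInfo T lam η)⁻¹ = L := by
    rw [toEuclideanCLM_inv, hL, fisherOp, indicator_of_mem hη]
  have hsymm (v w : EuclideanSpace ℝ (Fin d)) : inner ℝ v (L w) = inner ℝ (L v) w := by
    have hadj : IsSelfAdjoint L := by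
      rw [← hL_eq]
      exact hI.inv.isHermitian.isSelfAdjoint.map _
    exact (hadj.isSymmetric v w).symm
  have hcancel : fisherOp T Θ lam η (L u) = u := by
    rw [← mul_apply_eq_comp, Ring.mul_inverse_cancel _ (isUnit_fisherOp hη hI),
      one_apply_eq_self]
  rw [← Matrix.inner_toEuclideanCLM, hL_eq, integral_intensityMeasure h.measurableSet
    (h.measurable η hη) fun t ht => (h.pos η hη t ht).le]
  calc inner ℝ u (L u) = inner ℝ (L u) (fisherOp T Θ lam η (L u)) := by
        rw [hcancel, real_inner_comm]
    _ = ∫ t in T, lam η t • inner ℝ (L u) (logGrad lam η t) ^ 2 := h.inner_fisherOp_self hη _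
    _ = ∫ t in T, lam η t • inner ℝ u (influence T Θ lam M η t) ^ 2 := by
        refine setIntegral_congr_fun h.measurableSet fun t ht => ?_
        simp only [influence, truncInverse_eq hM.le, scoreFunction, indicator_of_mem hη,
          indicator_of_mem ht, ← hL, hsymm]

end RegularIntensity

end Influence

section OneStepMLE

variable {d : ℕ} {T : Set ℝ} {Θ : Set (EuclideanSpace ℝ (Fin d))}
  {lam : EuclideanSpace ℝ (Fin d) → ℝ → ℝ} {C : ℝ≥0} {η : EuclideanSpace ℝ (Fin d)} {δ M : ℝ}
  {est : (n : ℕ) → (Fin n → Measure ℝ) → EuclideanSpace ℝ (Fin d)}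

namespace RegularIntensity

lemma oneStepMLE_eq (h : RegularIntensity T Θ lam C) (hη : η ∈ Θ) {x : ℕ → Measure ℝ}
    (hx : ∀ j, finitePart (x j) = x j) {n : ℕ} {θ : EuclideanSpace ℝ (Fin d)}
    (hθ : evalFirst est (learningSize δ n) x = θ) (hmem : θ ∈ Θ) :
    oneStepMLE T Θ lam δ est n x = θ + (n : ℝ)⁻¹ • Ring.inverse (fisherOp T Θ lam θ)
      (∑ j ∈ Finset.Ico (learningSize δ n) n,
        (compensatedIntegral (intensityMeasure T (lam η)) (scoreFunction T Θ lam θ) (x j) +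
          scoreMean T Θ lam η θ)) := by
  subst hθ
  simp only [oneStepMLE, if_pos hmem, toEuclideanLin_inv_fisherInfo hmem,
    h.score_eq hη hmem (hx _)]

lemma oneStepMLE_eq_sum_influence (h : RegularIntensity T Θ lam C) (hη : η ∈ Θ)
    {x : ℕ → Measure ℝ} (hx : ∀ j, finitePart (x j) = x j) {n : ℕ}
    {θ : EuclideanSpace ℝ (Fin d)} (hθ : evalFirst est (learningSize δ n) x = θ) (hmem : θ ∈ Θ)
    (hM : ‖Ring.inverse (fisherOp T Θ lam θ)‖ ≤ M) :
    oneStepMLE T Θ lam δ est n x = θ + (n : ℝ)⁻¹ • ∑ j ∈ Finset.Ico (learningSize δ n) n,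
      (compensatedIntegral (intensityMeasure T (lam η)) (influence T Θ lam M θ) (x j) +
        truncInverse M (fisherOp T Θ lam θ) (scoreMean T Θ lam η θ)) := by
  have := isFiniteMeasure_intensityMeasure (h.integrableOn η hη)
  have hcomp (j : ℕ) := compensatedIntegral_clm_comp (intensityMeasure T (lam η))
    (truncInverse M (fisherOp T Θ lam θ)) (h.measurable_scoreFunction θ)
    (h.norm_scoreFunction_le θ) (x j)
  rw [h.oneStepMLE_eq hη hx hθ hmem, ← truncInverse_eq hM, map_sum]
  simp only [map_add, ← hcomp]
  rfl

lemma aemeasurable_oneStepMLE (h : RegularIntensity T Θ lam C) (hη : η ∈ Θ) {Ω : Type*}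
    [MeasurableSpace Ω] {P : Measure Ω} {X : ℕ → Ω → Measure ℝ} (hX : ∀ j, Measurable (X j))
    (hfin : ∀ᵐ ω ∂P, ∀ j, finitePart (X j ω) = X j ω) (hest : ∀ n, Measurable (est n)) (n : ℕ) :
    AEMeasurable (fun ω => oneStepMLE T Θ lam δ est n fun j => X j ω) P := by
  classical
  have := isFiniteMeasure_intensityMeasure (h.integrableOn η hη)
  let U : Ω → EuclideanSpace ℝ (Fin d) := fun ω => evalFirst est (learningSize δ n) fun j => X j ω
  have hU : Measurable U := measurable_evalFirst hX hest _
  have hscore (j : ℕ) : Measurable fun ω => compensatedIntegral (intensityMeasure T (lam η))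
      (scoreFunction T Θ lam (U ω)) (X j ω) + scoreMean T Θ lam η (U ω) :=
    ((measurable_compensatedIntegral_uncurry _ h.measurable_uncurry_scoreFunction).comp
      (hU.prodMk (hX j))).add ((h.measurable_scoreMean hη).comp hU)
  have hinv : Measurable fun ω => Ring.inverse (fisherOp T Θ lam (U ω)) :=
    (measurable_ringInverse.comp h.measurable_fisherOp).comp hU
  let S : Ω → EuclideanSpace ℝ (Fin d) := fun ω => ∑ j ∈ Finset.Ico (learningSize δ n) n,
    (compensatedIntegral (intensityMeasure T (lam η)) (scoreFunction T Θ lam (U ω)) (X j ω) +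
      scoreMean T Θ lam η (U ω))
  have hS : Measurable S := Finset.measurable_fun_sum _ fun j _ => hscore j
  have hcorr : Measurable fun ω => Ring.inverse (fisherOp T Θ lam (U ω)) (S ω) :=
    ContinuousLinearMap.measurable_apply₂.comp (hinv.prodMk hS)
  have hstep : Measurable fun ω => if U ω ∈ Θ then
      U ω + (n : ℝ)⁻¹ • Ring.inverse (fisherOp T Θ lam (U ω)) (S ω) else U ω :=
    Measurable.ite (hU h.isOpen.measurableSet) (hU.add (hcorr.fun_const_smul (n : ℝ)⁻¹)) hU
  refine ⟨_, hstep, ?_⟩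
  filter_upwards [hfin] with ω hω
  by_cases hmem : U ω ∈ Θ
  · rw [h.oneStepMLE_eq hη hω rfl hmem, if_pos hmem]
  · rw [if_neg hmem, oneStepMLE]
    exact if_neg hmem

end RegularIntensity

end OneStepMLE

namespace ConditionL0

variable {d : ℕ} {T : Set ℝ} {Θ : Set (EuclideanSpace ℝ (Fin d))}
  {lam : EuclideanSpace ℝ (Fin d) → ℝ → ℝ}

lemma exists_regularIntensity (h : ConditionL0 T Θ lam) (hT : MeasurableSet T) (hΘ : IsOpen Θ)
    (hmeas : ∀ θ ∈ Θ, Measurable (lam θ)) (hint : ∀ θ ∈ Θ, IntegrableOn (lam θ) T) :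
    ∃ C, RegularIntensity T Θ lam C := by
  obtain ⟨C, hC⟩ := h.bounded
  exact ⟨C.toNNReal,
    { measurableSet := hT
      isOpen := hΘ
      measurable := hmeas
      integrableOn := hint
      pos := h.pos
      contDiffOn := fun t ht => (h.contDiffOn t ht).of_le (by norm_num)
      norm_iteratedFDeriv_le := fun k hk θ hθ t ht =>
        (hC k (Finset.Icc_subset_Icc_right (by norm_num) hk) θ hθ t ht).trans
          (Real.le_coe_toNNReal C) }⟩

lemma posDef_fisherInfo (h : ConditionL0 T Θ lam) {θ : EuclideanSpace ℝ (Fin d)} (hθ : θ ∈ Θ) :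
    (fisherInfo T lam θ).PosDef := by
  obtain ⟨c, hc, hnd⟩ := h.nondegenerate
  refine Matrix.PosDef.of_dotProduct_mulVec_pos ?_ fun x hx => ?_
  · ext i j
    simp only [Matrix.conjTranspose_apply, star_trivial, fisherInfo, Matrix.of_apply,
      mul_comm (intensityGrad lam θ _ i)]
  · set v := WithLp.toLp 2 x with hv
    have hv_norm : 0 < ‖v‖ := norm_pos_iff.2 fun h0 => hx (by simpa [hv] using h0)
    have hunit := hc.trans_le (hnd θ hθ (‖v‖⁻¹ • v) (by
      rw [norm_smul, norm_inv, norm_norm, inv_mul_cancel₀ hv_norm.ne']))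
    rw [map_smul, inner_smul_left, inner_smul_right, conj_trivial] at hunit
    have hinner : 0 < inner ℝ v (Matrix.toEuclideanLin (fisherInfo T lam θ) v) := by
      simpa [hv_norm] using hunit
    rwa [EuclideanSpace.inner_eq_star_dotProduct, Matrix.toLpLin_apply, dotProduct_comm] at hinner

end ConditionL0

end PoissonOneStep

theorem theorem2_general {Ω : Type*} [MeasurableSpace Ω] {P : Measure Ω} [IsProbabilityMeasure P]
    {d : ℕ} {T : Set ℝ} {Θ : Set (EuclideanSpace ℝ (Fin d))}
    {lam : EuclideanSpace ℝ (Fin d) → ℝ → ℝ} {C : NNReal} (h : RegularIntensity T Θ lam C)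
    {θ₀ : EuclideanSpace ℝ (Fin d)} (hθ₀ : θ₀ ∈ Θ) (hI : (fisherInfo T lam θ₀).PosDef)
    {X : ℕ → Ω → Measure ℝ} (hX : ∀ j, IsPoissonProcess P T (lam θ₀) (X j))
    (hX_indep : iIndepFun X P)
    {est : (n : ℕ) → (Fin n → Measure ℝ) → EuclideanSpace ℝ (Fin d)}
    (hest : ∀ n, Measurable (est n)) {δ : ℝ} (hδ : δ ∈ Ioo (1 / 2 : ℝ) 1)
    (hbdd : BoundedInProbability P fun n ω =>
      √(n : ℝ) • (evalFirst est n (fun j => X j ω) - θ₀)) :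
    TendstoInDistribution
      (fun (n : ℕ) ω => √(n : ℝ) • (oneStepMLE T Θ lam δ est n (fun j => X j ω) - θ₀))
      atTop id (fun _ => P) (multivariateGaussian 0 (fisherInfo T lam θ₀)⁻¹) := by
  have := isFiniteMeasure_intensityMeasure (h.integrableOn θ₀ hθ₀)
  have hXm (j : ℕ) : Measurable (X j) := (hX j).measurable
  have hPRM (j : ℕ) : IsPoissonRandomMeasure P (intensityMeasure T (lam θ₀)) (X j) :=
    ((hX j).hasPoissonIncrements h.measurableSet (h.integrableOn θ₀ hθ₀)
      fun t ht => (h.pos θ₀ hθ₀ t ht).le).isPoissonRandomMeasure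
  have hfin : ∀ᵐ ω ∂P, ∀ j, finitePart (X j ω) = X j ω :=
    ae_all_iff.2 fun j => (hPRM j).ae_finitePart_eq
  obtain ⟨M, hM⟩ := exists_gt ‖Ring.inverse (fisherOp T Θ lam θ₀)‖
  have hM₀ : 0 ≤ M := (norm_nonneg _).trans hM.le
  have hinf (θ : EuclideanSpace ℝ (Fin d)) : Measurable (influence T Θ lam M θ) :=
    (h.measurable_uncurry_influence M).of_uncurry_left
  have hcont := tendsto_lintegral_enorm_sub_sq (intensityMeasure T (lam θ₀)) hinf
    (h.norm_influence_le hM₀) (h.continuousAt_influence hθ₀ hI hM)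
  have hU : BoundedInProbability P fun n ω => √(learningSize δ n : ℝ) •
      (evalFirst est (learningSize δ n) (fun j => X j ω) - θ₀) :=
    fun ε hε => (hbdd ε hε).imp fun M hM n => hM (learningSize δ n)
  refine tendstoInDistribution_oneStep (f := influence T Θ lam M)
    (b := fun θ => truncInverse M (fisherOp T Θ lam θ) (scoreMean T Θ lam θ₀ θ))
    hPRM hX_indep (h.measurable_uncurry_influence M) (h.norm_influence_le hM₀) hcont
    (h.isBigO_truncInverse_scoreMean_sub hθ₀ hI hM) hI.inv.posSemidef
    (h.dotProduct_inv_fisherInfo_mulVec hθ₀ hI hM)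
    (tendsto_learningSize (one_half_pos.trans hδ.1)) (tendsto_learningSize_div hδ.2)
    (tendsto_sqrt_div_learningSize hδ.1) (fun n => measurable_evalFirst hXm hest _)
    (fun n => indepFun_evalFirst hXm hX_indep hest _ n) hU
    (fun n => h.aemeasurable_oneStepMLE hθ₀ hXm hfin hest n)
    (h.eventually_mem_and_norm_ringInverse_fisherOp_le hθ₀ hI hM) fun n => ?_
  exact hfin.mono fun ω hω hmem => h.oneStepMLE_eq_sum_influence hθ₀ hω rfl hmem.1 hmem.2

theorem theorem2 {Ω : Type*} [MeasurableSpace Ω] (P : Measure Ω) [IsProbabilityMeasure P]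
    {d : ℕ} (T : Set ℝ) (hT : T.OrdConnected)
    (Θ : Set (EuclideanSpace ℝ (Fin d))) (hΘ_open : IsOpen Θ) (hΘ_convex : Convex ℝ Θ)
    (hΘ_bdd : Bornology.IsBounded Θ)
    (lam : EuclideanSpace ℝ (Fin d) → ℝ → ℝ)
    (hlam_meas : ∀ θ ∈ Θ, Measurable (lam θ))
    (hlam_int : ∀ θ ∈ Θ, IntegrableOn (lam θ) T)
    (θ₀ : EuclideanSpace ℝ (Fin d)) (hθ₀ : θ₀ ∈ Θ)
    (X : ℕ → Ω → Measure ℝ)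
    (hX : ∀ j, IsPoissonProcess P T (lam θ₀) (X j))
    (hX_indep : iIndepFun X P)
    (est : (n : ℕ) → (Fin n → Measure ℝ) → EuclideanSpace ℝ (Fin d))
    (hest : ∀ n, Measurable (est n))
    (δ : ℝ) (hδ : δ ∈ Ioo (1 / 2 : ℝ) 1)
    (hP0 : ConditionP0 P θ₀ X est)
    (hL0 : ConditionL0 T Θ lam) :
    TendstoInDistribution
      (fun (n : ℕ) ω => √(n : ℝ) • (oneStepMLE T Θ lam δ est n (fun j => X j ω) - θ₀))
      atTop id (fun _ => P) (multivariateGaussian 0 (fisherInfo T lam θ₀)⁻¹) := by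
  obtain ⟨C, h⟩ := hL0.exists_regularIntensity hT.measurableSet hΘ_open hlam_meas hlam_int
  exact theorem2_general h hθ₀ (hL0.posDef_fisherInfo hθ₀) hX hX_indep hest hδ hP0.bounded_in_prob
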